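/- Let $H$ be a complex Hilbert space. Let $A:\mathscr D(A)\subset H\to H$ be a self-adjoint operator for which there is a constant $c>0$ with $\langle Au,u\rangle_H\ge c\|u\|_H^2$ for all $u\in\mathscr D(A)$; let $V:=\mathscr D(A^{1/2})$ with norm $\|u\|_V:=\|A^{1/2}u\|_H$, and let $\mathbb H:=V\times H$ carry the product Hilbert space structure. Let $B:\mathscr D(B)\subset H\to H$ be a densely defined closed linear operator such that $\mathscr D(B)\cap V$ and $A^{1/2}(\mathscr D(B)\cap V)$ are dense in $H$ and the operator $A^{-1/2}BA^{-1/2}$, defined on $A^{1/2}(\mathscr D(B)\cap V)$, is bounded, i.e. is the restriction of an operator in $\mathscr L(H)$. Assume that there are constants $\gamma\ge 0$ and $\alpha>0$ such that, for all $v\in\mathscr D(B)$, $$\gamma\,\mathrm{Re}\langle Bv,v\rangle_H\le -|\mathrm{Im}\langle Bv,v\rangle_H|\qquad\text{and}\qquad \mathrm{Re}\langle Bv,v\rangle_H\le -2\alpha\|v\|_H^2 .$$ Let $$\Lambda=\begin{pmatrix}0&I\\-A&B\end{pmatrix},\qquad \mathscr D(\Lambda)=\mathscr D(A)\times\big(\mathscr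 D(A^{1/2})\cap\mathscr D(B)\big),$$ and assume that $\Lambda$ generates a contraction $C_0$-semigroup $e^{t\Lambda}$, $t\ge 0$, on $\mathbb H$. Let $w_s(\Lambda):=\sup\{\mathrm{Re}\,\lambda:\lambda\in\sigma(\Lambda)\}$ be the spectral bound and $w_g(\Lambda):=\inf\{\mu\in\mathbb R:\ \exists M\ge 1\ \forall t\ge 0\ \|e^{t\Lambda}\|\le Me^{\mu t}\}$ the growth bound of $\Lambda$, both taken in $[-\infty,\infty]$ (so $\sup\emptyset=-\infty$). Then $$w_g(\Lambda)\le\max\{w_s(\Lambda),-\alpha\}<0 .$$ In particular the semigroup is exponentially stable: there are $M\ge 1$ and $\mu>0$ with $\|e^{t\Lambda}\|\le Me^{-\mu t}$ for all $t\ge 0$. -/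

import Mathlib

noncomputable section

namespace SecondOrder

open Filter Topology

/-! ### Spectrum of an unbounded operator, `C₀`-semigroups, growth and spectral bounds -/

section General

variable {E : Type*} [NormedAddCommGroup E] [NormedSpace ℂ E]

/-- `R` is the (bounded, everywhere defined) resolvent operator `(z - L)⁻¹` of the possibly
unbounded operator `L`. -/
def IsResolventAt (L : E →ₗ.[ℂ] E) (z : ℂ) (R : E →L[ℂ] E) : Prop :=
  (∀ x : E, ∃ hx : R x ∈ L.domain, z • R x - L ⟨R x, hx⟩ = x) ∧
    ∀ u : L.domain, R (z • (u : E) - L u) = u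

/-- The resolvent set of an unbounded operator. -/
def resolventSet (L : E →ₗ.[ℂ] E) : Set ℂ := {z | ∃ R : E →L[ℂ] E, IsResolventAt L z R}

/-- The spectrum of an unbounded operator. -/
def spectralSet (L : E →ₗ.[ℂ] E) : Set ℂ := (resolventSet L)ᶜ

/-- The spectral bound `sup {Re z : z ∈ σ(L)}`, an extended real number
(it is `-∞` if the spectrum is empty). -/
def spectralBound (L : E →ₗ.[ℂ] E) : EReal := ⨆ z ∈ spectralSet L, ((z.re : ℝ) : EReal)

/-- `T t`, `t ≥ 0`, is a strongly continuous semigroup of bounded linear operators.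
(The values of `T` at negative times are irrelevant.) -/
structure IsC0Semigroup (T : ℝ → E →L[ℂ] E) : Prop where
  map_zero : T 0 = 1
  map_add : ∀ s t : ℝ, 0 ≤ s → 0 ≤ t → T (s + t) = T s * T t
  tendsto_zero : ∀ x : E, Tendsto (fun t : ℝ => T t x) (𝓝[>] 0) (𝓝 x)

/-- `L` is the infinitesimal generator of `T`: its graph consists of exactly those `(x, y)` for
which `(T t x - x) / t` tends to `y` as `t` decreases to `0`. -/
def IsGenerator (T : ℝ → E →L[ℂ] E) (L : E →ₗ.[ℂ] E) : Prop :=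
  ∀ x y : E, (∃ hx : x ∈ L.domain, L ⟨x, hx⟩ = y) ↔
    Tendsto (fun t : ℝ => ((t : ℂ)⁻¹) • (T t x - x)) (𝓝[>] 0) (𝓝 y)

/-- The growth bound
`inf {μ ∈ ℝ : there is M ≥ 1 with ‖T t‖ ≤ M exp (μ t) for all t ≥ 0}`,
an extended real number (it may be `-∞`). -/
def growthBound (T : ℝ → E →L[ℂ] E) : EReal :=
  sInf {w : EReal | ∃ μ : ℝ, w = (μ : EReal) ∧
    ∃ M : ℝ, 1 ≤ M ∧ ∀ t : ℝ, 0 ≤ t → ‖T t‖ ≤ M * Real.exp (μ * t)}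

end General

/-! ### Self-adjoint operators with a positive lower bound and their square roots -/

variable {H : Type*} [NormedAddCommGroup H] [InnerProductSpace ℂ H] [CompleteSpace H]

/-- `A` is self-adjoint and `⟨A u, u⟩ ≥ c ‖u‖²` for some constant `c > 0`. -/
structure IsStrictlyPositive (A : H →ₗ.[ℂ] H) : Prop where
  selfAdjoint : IsSelfAdjoint A
  lowerBound : ∃ c : ℝ, 0 < c ∧
    ∀ u : A.domain, c * ‖(u : H)‖ ^ 2 ≤ (inner ℂ (A u) (u : H)).re

namespace IsStrictlyPositive

variable {A : H →ₗ.[ℂ] H}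

theorem symm (hA : IsStrictlyPositive A) (u v : A.domain) :
    inner ℂ (A u) (v : H) = inner ℂ (u : H) (A v) := by
  have h := LinearPMap.adjoint_isFormalAdjoint hA.selfAdjoint.dense_domain
  rw [LinearPMap.isSelfAdjoint_def.mp hA.selfAdjoint] at h
  exact h u v

theorem exists_norm_le (hA : IsStrictlyPositive A) :
    ∃ c : ℝ, 0 < c ∧ ∀ u : A.domain, c * ‖(u : H)‖ ≤ ‖A u‖ := by
  obtain ⟨c, hc, h⟩ := hA.lowerBound
  refine ⟨c, hc, fun u => ?_⟩
  have h1 := (h u).trans ((Complex.re_le_norm _).trans (norm_inner_le_norm (A u) (u : H)))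
  rcases (norm_nonneg (u : H)).eq_or_lt with h0 | h0
  · rw [← h0]; simp
  · nlinarith

theorem injective (hA : IsStrictlyPositive A) {u v : A.domain} (h : A u = A v) : u = v := by
  obtain ⟨c, hc, hb⟩ := hA.exists_norm_le
  have h1 := hb (u - v)
  rw [LinearPMap.map_sub, h, sub_self, norm_zero] at h1
  have h2 : ‖((u - v : A.domain) : H)‖ = 0 := by
    have := norm_nonneg ((u - v : A.domain) : H)
    nlinarith
  rw [norm_eq_zero] at h2
  exact sub_eq_zero.mp (Subtype.ext h2)

theorem surjective (hA : IsStrictlyPositive A) (x : H) : ∃ u : A.domain, A u = x := by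
  obtain ⟨c, hc, hb⟩ := hA.exists_norm_le
  set S : Submodule ℂ H := LinearMap.range A.toFun with hS
  have hclosed : IsClosed (S : Set H) := by
    refine IsSeqClosed.isClosed ?_
    intro f y hf hy
    choose u hu using hf
    have hu' : ∀ n, A (u n) = f n := hu
    have hcau : CauchySeq fun n => ((u n : A.domain) : H) := by
      rw [Metric.cauchySeq_iff']
      intro ε hε
      obtain ⟨N, hN⟩ := Metric.cauchySeq_iff'.mp hy.cauchySeq (c * ε) (by positivity)
      refine ⟨N, fun n hn => ?_⟩
      have h1 := hN n hn
      rw [dist_eq_norm, ← hu', ← hu', ← LinearPMap.map_sub] at h1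
      have h2 := (hb (u n - u N)).trans_lt h1
      rw [dist_eq_norm]
      exact lt_of_mul_lt_mul_left h2 hc.le
    obtain ⟨w, hw⟩ := cauchySeq_tendsto_of_complete hcau
    have hg : (w, y) ∈ A.graph := by
      refine hA.selfAdjoint.isClosed.mem_of_tendsto (hw.prodMk_nhds hy)
        (Eventually.of_forall fun n => ?_)
      change ((u n : H), f n) ∈ A.graph
      rw [← hu' n]
      exact A.mem_graph (u n)
    obtain ⟨v, -, hv⟩ := (LinearPMap.mem_graph_iff A).mp hg
    exact ⟨v, hv⟩
  have hbot : Sᗮ = ⊥ := by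
    rw [eq_bot_iff]
    intro w hw
    have hw0 : ∀ u : A.domain, inner ℂ w (A u) = 0 := fun u =>
      (Submodule.mem_orthogonal' S w).mp hw _ ⟨u, rfl⟩
    have hmem : w ∈ (LinearPMap.adjoint A).domain :=
      LinearPMap.mem_adjoint_domain_of_exists w ⟨0, fun u => by rw [hw0 u, inner_zero_left]⟩
    have hval : LinearPMap.adjoint A ⟨w, hmem⟩ = 0 :=
      LinearPMap.adjoint_apply_eq hA.selfAdjoint.dense_domain ⟨w, hmem⟩
        fun u => by rw [hw0 u, inner_zero_left]
    have hmem' : w ∈ A.domain := by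
      rw [← LinearPMap.isSelfAdjoint_def.mp hA.selfAdjoint]; exact hmem
    have hval' : A ⟨w, hmem'⟩ = 0 := by
      rw [← hval]
      have he := (LinearPMap.ext_iff.mp (LinearPMap.isSelfAdjoint_def.mp hA.selfAdjoint)).2
      exact (he (hf := hmem) (hg := hmem')).symm
    have := hb ⟨w, hmem'⟩
    rw [hval', norm_zero] at this
    have h0 : ‖w‖ = 0 := by
      have := norm_nonneg w
      simp only at *
      nlinarith
    simpa using h0
  have htop : S = ⊤ := by
    have : CompleteSpace S := hclosed.completeSpace_coe
    exact (Submodule.orthogonal_eq_bot_iff).mp hbot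
  have hx : x ∈ S := by rw [htop]; trivial
  obtain ⟨u, hu⟩ := hx
  exact ⟨u, hu⟩

/-- A strictly positive self-adjoint operator has a bounded, everywhere defined inverse. -/
theorem exists_inv (hA : IsStrictlyPositive A) :
    ∃ G : H →L[ℂ] H, ∀ x : H, ∃ hx : G x ∈ A.domain, A ⟨G x, hx⟩ = x := by
  obtain ⟨c, hc, hb⟩ := hA.exists_norm_le
  choose g hg using hA.surjective
  refine ⟨LinearMap.mkContinuous
    { toFun := fun x => (g x : H)
      map_add' := fun x y => ?_
      map_smul' := fun a x => ?_ } c⁻¹ fun x => ?_, fun x => ⟨(g x).2, hg x⟩⟩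
  · rw [← Submodule.coe_add]
    exact congrArg _ (hA.injective (by rw [LinearPMap.map_add, hg, hg, hg]))
  · rw [RingHom.id_apply, ← Submodule.coe_smul]
    exact congrArg _ (hA.injective (by rw [LinearPMap.map_smul, hg, hg]))
  · have := hb (g x)
    rw [hg] at this
    change ‖(g x : H)‖ ≤ c⁻¹ * ‖x‖
    rwa [← div_eq_inv_mul, le_div_iff₀' hc]

/-- The bounded operator `A⁻¹`. -/
def inv (hA : IsStrictlyPositive A) : H →L[ℂ] H := hA.exists_inv.choose

theorem inv_mem (hA : IsStrictlyPositive A) (x : H) : hA.inv x ∈ A.domain :=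
  (hA.exists_inv.choose_spec x).1

theorem apply_inv (hA : IsStrictlyPositive A) (x : H) : A ⟨hA.inv x, hA.inv_mem x⟩ = x :=
  (hA.exists_inv.choose_spec x).2

theorem inv_nonneg (hA : IsStrictlyPositive A) : 0 ≤ hA.inv := by
  rw [ContinuousLinearMap.nonneg_iff_isPositive]
  refine ⟨fun x y => ?_, fun x => ?_⟩
  · have h := hA.symm ⟨_, hA.inv_mem x⟩ ⟨_, hA.inv_mem y⟩
    rw [hA.apply_inv, hA.apply_inv] at h
    exact h.symm
  · obtain ⟨c, hc, h⟩ := hA.lowerBound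
    have h1 := h ⟨_, hA.inv_mem x⟩
    rw [hA.apply_inv] at h1
    have h2 : (0 : ℝ) ≤ (inner ℂ x (hA.inv x)).re := le_trans (by positivity) h1
    rw [ContinuousLinearMap.reApplyInnerSelf_apply, inner_re_symm]
    exact h2

/-- The bounded operator `A^{-1/2}`, the nonnegative square root of `A⁻¹`. -/
def invSqrt (hA : IsStrictlyPositive A) : H →L[ℂ] H := CFC.sqrt hA.inv

theorem invSqrt_invSqrt (hA : IsStrictlyPositive A) (x : H) :
    hA.invSqrt (hA.invSqrt x) = hA.inv x := by
  have h : hA.invSqrt * hA.invSqrt = hA.inv := CFC.sqrt_mul_sqrt_self hA.inv hA.inv_nonneg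
  rw [← h]; rfl

theorem invSqrt_injective (hA : IsStrictlyPositive A) : Function.Injective hA.invSqrt := by
  intro x y hxy
  have h : hA.inv x = hA.inv y := by
    rw [← hA.invSqrt_invSqrt, ← hA.invSqrt_invSqrt, hxy]
  rw [← hA.apply_inv x, ← hA.apply_inv y]
  exact congrArg A (Subtype.ext h)

/-- The operator `A^{1/2}`, the inverse of `A^{-1/2}`; its domain is the range of `A^{-1/2}`. -/
def sqrt (hA : IsStrictlyPositive A) : H →ₗ.[ℂ] H where
  domain := LinearMap.range (hA.invSqrt : H →ₗ[ℂ] H)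
  toFun := (LinearEquiv.ofInjective (hA.invSqrt : H →ₗ[ℂ] H) hA.invSqrt_injective).symm.toLinearMap

theorem invSqrt_sqrt (hA : IsStrictlyPositive A) (u : hA.sqrt.domain) :
    hA.invSqrt (hA.sqrt u) = u :=
  congrArg Subtype.val ((LinearEquiv.ofInjective (hA.invSqrt : H →ₗ[ℂ] H)
    hA.invSqrt_injective).apply_symm_apply u)

theorem sqrt_injective (hA : IsStrictlyPositive A) : Function.Injective hA.sqrt.toFun :=
  (LinearEquiv.ofInjective (hA.invSqrt : H →ₗ[ℂ] H) hA.invSqrt_injective).symm.injective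

theorem invSqrt_mem (hA : IsStrictlyPositive A) (x : H) : hA.invSqrt x ∈ hA.sqrt.domain :=
  ⟨x, rfl⟩

theorem sqrt_invSqrt (hA : IsStrictlyPositive A) (x : H) :
    hA.sqrt ⟨hA.invSqrt x, hA.invSqrt_mem x⟩ = x :=
  hA.invSqrt_injective (hA.invSqrt_sqrt _)

theorem inv_apply (hA : IsStrictlyPositive A) (u : A.domain) : hA.inv (A u) = u :=
  congrArg Subtype.val (hA.injective (hA.apply_inv (A u)))

/-- `A^{1/2}` is a square root of `A`, with the correct domain. -/
theorem sqrt_sqrt_iff (hA : IsStrictlyPositive A) (u w : H) :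
    (∃ (hu : u ∈ hA.sqrt.domain) (hu' : hA.sqrt ⟨u, hu⟩ ∈ hA.sqrt.domain),
      hA.sqrt ⟨hA.sqrt ⟨u, hu⟩, hu'⟩ = w) ↔ ∃ hu : u ∈ A.domain, A ⟨u, hu⟩ = w := by
  constructor
  · rintro ⟨hu, hu', rfl⟩
    have h : hA.inv (hA.sqrt ⟨hA.sqrt ⟨u, hu⟩, hu'⟩) = u := by
      rw [← hA.invSqrt_invSqrt, hA.invSqrt_sqrt, hA.invSqrt_sqrt]
    have h2 := hA.apply_inv (hA.sqrt ⟨hA.sqrt ⟨u, hu⟩, hu'⟩)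
    have h3 := hA.inv_mem (hA.sqrt ⟨hA.sqrt ⟨u, hu⟩, hu'⟩)
    exact ⟨h ▸ h3, (congrArg A (Subtype.ext h.symm)).trans h2⟩
  · rintro ⟨hu, rfl⟩
    have h : hA.invSqrt (hA.invSqrt (A ⟨u, hu⟩)) = u := by
      rw [hA.invSqrt_invSqrt, hA.inv_apply]
    have hmem : u ∈ hA.sqrt.domain := ⟨_, h⟩
    have h1 : hA.sqrt ⟨u, hmem⟩ = hA.invSqrt (A ⟨u, hu⟩) :=
      hA.invSqrt_injective (by rw [hA.invSqrt_sqrt, h])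
    have hmem' : hA.sqrt ⟨u, hmem⟩ ∈ hA.sqrt.domain := by rw [h1]; exact hA.invSqrt_mem _
    exact ⟨hmem, hmem', hA.invSqrt_injective (by rw [hA.invSqrt_sqrt]; exact h1)⟩

/-- `A^{1/2}` is nonnegative. -/
theorem sqrt_nonneg (hA : IsStrictlyPositive A) (u : hA.sqrt.domain) :
    0 ≤ (inner ℂ (hA.sqrt u) (u : H)).re := by
  have h : (0 : H →L[ℂ] H) ≤ hA.invSqrt := CFC.sqrt_nonneg _
  rw [ContinuousLinearMap.nonneg_iff_isPositive] at h
  have h1 := h.re_inner_nonneg_right (hA.sqrt u)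
  rwa [hA.invSqrt_sqrt] at h1

end IsStrictlyPositive

/-! ### The energy space `V`, the state space `V × H` and the operator matrix -/

/-- The space `V = 𝒟(A^{1/2})`, normed by `‖u‖_V = ‖A^{1/2} u‖`. -/
def EnergySpace {A : H →ₗ.[ℂ] H} (hA : IsStrictlyPositive A) : Type _ := hA.sqrt.domain

namespace EnergySpace

variable {A : H →ₗ.[ℂ] H} {hA : IsStrictlyPositive A}

instance : AddCommGroup (EnergySpace hA) := inferInstanceAs (AddCommGroup hA.sqrt.domain)

instance : Module ℂ (EnergySpace hA) := inferInstanceAs (Module ℂ hA.sqrt.domain)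

/-- The inclusion `V ⊆ H`. -/
def incl (hA : IsStrictlyPositive A) : EnergySpace hA →ₗ[ℂ] H := hA.sqrt.domain.subtype

/-- An element of `𝒟(A^{1/2})`, regarded as an element of the energy space `V`. -/
def mk (hA : IsStrictlyPositive A) (u : H) (hu : u ∈ hA.sqrt.domain) : EnergySpace hA := ⟨u, hu⟩

/-- The map `A^{1/2} : V → H`. -/
def root (hA : IsStrictlyPositive A) : EnergySpace hA →ₗ[ℂ] H := hA.sqrt.toFun

theorem root_injective (hA : IsStrictlyPositive A) : Function.Injective (root hA) :=
  hA.sqrt_injective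

instance : NormedAddCommGroup (EnergySpace hA) :=
  NormedAddCommGroup.induced (EnergySpace hA) H (root hA) (root_injective hA)

theorem norm_def (u : EnergySpace hA) : ‖u‖ = ‖root hA u‖ := rfl

/-- The inner product `⟨u, v⟩_V = ⟨A^{1/2} u, A^{1/2} v⟩`. -/
instance : InnerProductSpace ℂ (EnergySpace hA) where
  norm_smul_le a u := by rw [norm_def, norm_def, map_smul, norm_smul]
  inner u v := inner ℂ (root hA u) (root hA v)
  norm_sq_eq_re_inner u := norm_sq_eq_re_inner (𝕜 := ℂ) (root hA u)
  conj_inner_symm u v := inner_conj_symm _ _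
  add_left u v w := by rw [map_add]; exact inner_add_left _ _ _
  smul_left u v a := by rw [map_smul]; exact inner_smul_left _ _ _

instance : CompleteSpace (EnergySpace hA) := by
  have hi : Isometry (root hA) := AddMonoidHomClass.isometry_of_norm (root hA) fun _ => rfl
  refine (completeSpace_iff_isComplete_range hi.isUniformInducing).mpr ?_
  have hr : Set.range (root hA) = Set.univ :=
    Set.range_eq_univ.mpr fun x => ⟨mk hA (hA.invSqrt x) (hA.invSqrt_mem x), hA.sqrt_invSqrt x⟩
  rw [hr]
  exact completeSpace_iff_isComplete_univ.mp inferInstance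

end EnergySpace

/-- The Hilbert space `V × H` with the product inner product. -/
abbrev StateSpace {A : H →ₗ.[ℂ] H} (hA : IsStrictlyPositive A) : Type _ :=
  WithLp 2 (EnergySpace hA × H)

/-- The domain `𝒟(A) × (𝒟(A^{1/2}) ∩ 𝒟(B))`, as a subspace of `V × H`. -/
def waveDomain {A : H →ₗ.[ℂ] H} (hA : IsStrictlyPositive A) (B : H →ₗ.[ℂ] H) :
    Submodule ℂ (StateSpace hA) where
  carrier := {y | EnergySpace.incl hA y.fst ∈ A.domain ∧ y.snd ∈ hA.sqrt.domain ⊓ B.domain}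
  zero_mem' := by
    refine ⟨?_, Submodule.zero_mem _⟩
    change EnergySpace.incl hA 0 ∈ A.domain
    rw [map_zero]; exact Submodule.zero_mem _
  add_mem' {x y} hx hy := by
    refine ⟨?_, Submodule.add_mem _ hx.2 hy.2⟩
    change EnergySpace.incl hA (x.fst + y.fst) ∈ A.domain
    rw [map_add]; exact Submodule.add_mem _ hx.1 hy.1
  smul_mem' a x hx := by
    refine ⟨?_, Submodule.smul_mem _ a hx.2⟩
    change EnergySpace.incl hA (a • x.fst) ∈ A.domain
    rw [map_smul]; exact Submodule.smul_mem _ a hx.1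

/-- The operator matrix `Λ = [[0, I], [-A, B]]` on `V × H`, i.e. `Λ (u, v) = (v, -A u + B v)`. -/
def waveOperator {A : H →ₗ.[ℂ] H} (hA : IsStrictlyPositive A) (B : H →ₗ.[ℂ] H) :
    StateSpace hA →ₗ.[ℂ] StateSpace hA where
  domain := waveDomain hA B
  toFun :=
    { toFun := fun y => WithLp.toLp 2
        (EnergySpace.mk hA y.1.snd y.2.2.1,
          -A ⟨EnergySpace.incl hA y.1.fst, y.2.1⟩ + B ⟨y.1.snd, y.2.2.2⟩)
      map_add' := fun x y => by
        have h1 : A ⟨EnergySpace.incl hA (x + y).1.fst, (x + y).2.1⟩ =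
            A ⟨EnergySpace.incl hA x.1.fst, x.2.1⟩ + A ⟨EnergySpace.incl hA y.1.fst, y.2.1⟩ := by
          rw [← LinearPMap.map_add]; rfl
        have h2 : B ⟨(x + y).1.snd, (x + y).2.2.2⟩ =
            B ⟨x.1.snd, x.2.2.2⟩ + B ⟨y.1.snd, y.2.2.2⟩ := by
          rw [← LinearPMap.map_add]; rfl
        rw [h1, h2, ← WithLp.toLp_add, Prod.mk_add_mk]
        congr 2
        abel
      map_smul' := fun a x => by
        have h1 : A ⟨EnergySpace.incl hA (a • x).1.fst, (a • x).2.1⟩ =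
            a • A ⟨EnergySpace.incl hA x.1.fst, x.2.1⟩ := by
          rw [← LinearPMap.map_smul]; rfl
        have h2 : B ⟨(a • x).1.snd, (a • x).2.2.2⟩ = a • B ⟨x.1.snd, x.2.2.2⟩ := by
          rw [← LinearPMap.map_smul]; rfl
        rw [h1, h2, RingHom.id_apply, ← WithLp.toLp_smul, Prod.smul_mk, smul_add, smul_neg]
        rfl }

end SecondOrder

end

/-! ### Plancherel's theorem for Hilbert-valued functions. -/

namespace SecondOrder
open Filter Topology MeasureTheory FourierTransform SchwartzMap

/-! On a Hilbert space, a uniform lower bound for `z - L` on a closed half plane `Re z ≥ ω` forces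
the rate `exp (ω t)` for a contraction semigroup (Gearhart–Prüss,
`exists_norm_le_exp_of_lower_bound`). The Fourier transform of a damped orbit is the resolvent on a
vertical line, so Plancherel turns the lower bound into an `L²` bound for orbits, and Datko's
argument turns that into decay.

It remains to bound `z - Λ` from below. Pair `(z - Λ) y = F` with `y = (u, v)`. The real part
controls the damped component `v`. The imaginary part controls `|Im z| * |‖u‖² - ‖v‖²|`, so at high
frequency the energy is nearly equally divided between `u` and `v`, and damping `v` at rate `2α`
damps the whole state at nearly `α`. This is `waveOperator_hasLowerBound_of_im_large`, valid for `Re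
z ≥ -α + ε` and `|Im z|` large. Where `Re z ≥ 1`, dissipativity suffices; the rest of the half plane
lies in a compact rectangle inside the resolvent set once `ω` exceeds the spectral bound.

The spectral bound is negative because the imaginary axis lies in the resolvent set: for `z ≠ 0` by
the same two energy estimates, for `z = 0` by solving the system through the bounded operator
`A^{-1/2} B A^{-1/2}`. Openness gives a strip at low frequency, and the high-frequency estimate
gives one elsewhere. -/

theorem continuous_fourier_of_integrable {F : Type*} [NormedAddCommGroup F] [NormedSpace ℂ F]
    {f : ℝ → F} (hf : Integrable f) : Continuous (𝓕 f) :=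
  VectorFourier.fourierIntegral_continuous Real.continuous_fourierChar
    (by exact continuous_inner) hf

/-- Both sides are locally integrable, so it suffices to test against smooth compactly supported
functions. Such a function is Schwartz; the `L²` transform is moved onto it by duality of tempered
distributions, the `L¹` transform by Fubini. -/
theorem coeFn_fourier_toLp_ae_eq {F : Type*} [NormedAddCommGroup F] [InnerProductSpace ℂ F]
    [CompleteSpace F] {f : ℝ → F} (hf : Integrable f) (hf2 : MemLp f 2) :
    (𝓕 (hf2.toLp f) : Lp F 2 (volume : Measure ℝ)) =ᵐ[volume] 𝓕 f := by
  refine ae_eq_of_integral_contDiff_smul_eq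
    ((Lp.memLp _).locallyIntegrable (by norm_num))
    (continuous_fourier_of_integrable hf).locallyIntegrable fun g hg hg' => ?_
  have h2 : HasCompactSupport (Complex.ofRealCLM ∘ g) := hg'.comp_left rfl
  have h3 : ContDiff ℝ (↑(⊤ : ℕ∞)) (Complex.ofRealCLM ∘ g) := Complex.ofRealCLM.contDiff.comp hg
  set φ : 𝓢(ℝ, ℂ) := h2.toSchwartzMap h3 with hφ
  have hφg : ∀ x, φ x = (g x : ℂ) := fun x => rfl
  have e := DFunLike.congr_fun (Lp.fourier_toTemperedDistribution_eq (hf2.toLp f)) φ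
  rw [TemperedDistribution.fourier_apply, Lp.toTemperedDistribution_apply,
    Lp.toTemperedDistribution_apply] at e
  simp only [hφg, Complex.coe_smul] at e
  rw [← e]
  have e2 := VectorFourier.integral_fourierIntegral_smul_eq_flip (f := φ) (g := f) (μ := volume)
    (ν := volume) (L := innerₗ ℝ) Real.continuous_fourierChar (by exact continuous_inner)
    φ.integrable hf
  rw [flip_innerₗ] at e2
  have e3 : ∫ x, (𝓕 φ : 𝓢(ℝ, ℂ)) x • (hf2.toLp f) x = ∫ x, (𝓕 φ : 𝓢(ℝ, ℂ)) x • f x := by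
    refine integral_congr_ae ?_
    filter_upwards [hf2.coeFn_toLp] with x hx
    rw [hx]
  rw [e3]
  refine e2.trans (integral_congr_ae (Eventually.of_forall fun x => ?_))
  simp only [hφg, Complex.coe_smul]
  rfl

/-- **Plancherel's theorem** for functions in `L¹ ∩ L²` with values in a Hilbert space. -/
theorem eLpNorm_fourier_eq {F : Type*} [NormedAddCommGroup F] [InnerProductSpace ℂ F]
    [CompleteSpace F] {f : ℝ → F} (hf : Integrable f) (hf2 : MemLp f 2) :
    eLpNorm (𝓕 f) 2 volume = eLpNorm f 2 volume := by
  rw [← eLpNorm_congr_ae (coeFn_fourier_toLp_ae_eq hf hf2), ← Lp.enorm_def, ← ofReal_norm,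
    Lp.norm_fourier_eq, ofReal_norm, Lp.enorm_toLp]
end SecondOrder

/-! ### Laplace transforms of semigroup orbits. -/

namespace SecondOrder
open Filter Topology MeasureTheory FourierTransform Set

theorem setIntegral_Ioi_comp_add {E : Type*} [NormedAddCommGroup E] [NormedSpace ℝ E]
    (g : ℝ → E) (h : ℝ) : ∫ t in Ioi (0 : ℝ), g (t + h) = ∫ t in Ioi h, g t := by
  rw [← integral_indicator measurableSet_Ioi, ← integral_indicator measurableSet_Ioi,
    ← integral_add_right_eq_self ((Ioi h).indicator g) h]
  congr 1
  ext t
  simp [indicator]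

section Semigroup

variable {E : Type*} [NormedAddCommGroup E] [NormedSpace ℂ E] {T : ℝ → E →L[ℂ] E}
  {L : E →ₗ.[ℂ] E}

theorem norm_apply_le_of_contraction (hcontr : ∀ t : ℝ, 0 ≤ t → ‖T t‖ ≤ 1) {t : ℝ} (ht : 0 ≤ t)
    (x : E) : ‖T t x‖ ≤ ‖x‖ := by
  simpa using (T t).le_of_opNorm_le (hcontr t ht) x

theorem IsC0Semigroup.norm_apply_sub_le (hT : IsC0Semigroup T)
    (hcontr : ∀ t : ℝ, 0 ≤ t → ‖T t‖ ≤ 1) {s t : ℝ} (hs : 0 ≤ s) (ht : 0 ≤ t) (x : E) :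
    ‖T t x - T s x‖ ≤ ‖T |t - s| x - x‖ := by
  wlog hst : s ≤ t generalizing s t
  · rw [norm_sub_rev, abs_sub_comm]
    exact this ht hs (le_of_not_ge hst)
  rw [abs_of_nonneg (sub_nonneg.2 hst)]
  have h : T t x = T s (T (t - s) x) := by
    rw [← mul_apply_eq_comp, ← hT.map_add s (t - s) hs (sub_nonneg.2 hst),
      add_sub_cancel]
  rw [h, ← map_sub]
  exact norm_apply_le_of_contraction hcontr hs _

/-- The absolute value removes the uncontrolled values at negative times, so that the orbit is
continuous on all of `ℝ` and measurability and differentiation of integrals come at once. -/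
theorem IsC0Semigroup.continuous_apply_abs (hT : IsC0Semigroup T)
    (hcontr : ∀ t : ℝ, 0 ≤ t → ‖T t‖ ≤ 1) (x : E) : Continuous fun t : ℝ => T |t| x := by
  have h0 : Tendsto (fun t : ℝ => T |t| x) (𝓝 0) (𝓝 x) := by
    rw [← nhdsNE_sup_pure, tendsto_sup]
    refine ⟨(hT.tendsto_zero x).comp (tendsto_abs_nhdsNE_zero), ?_⟩
    rw [tendsto_pure_left]
    intro s hs
    simpa [hT.map_zero] using mem_of_mem_nhds hs
  refine continuous_iff_continuousAt.2 fun s => ?_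
  rw [ContinuousAt, tendsto_iff_norm_sub_tendsto_zero]
  have h1 : Tendsto (fun t : ℝ => |t| - |s|) (𝓝 s) (𝓝 0) := by
    have : Continuous fun t : ℝ => |t| - |s| := by fun_prop
    simpa using this.tendsto s
  have h2 := tendsto_iff_norm_sub_tendsto_zero.1 (h0.comp h1)
  exact squeeze_zero (fun t => norm_nonneg _)
    (fun t => hT.norm_apply_sub_le hcontr (abs_nonneg s) (abs_nonneg t) x) h2

theorem IsC0Semigroup.integrableOn_laplace (hT : IsC0Semigroup T)
    (hcontr : ∀ t : ℝ, 0 ≤ t → ‖T t‖ ≤ 1) {M w : ℝ}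
    (hM : ∀ t : ℝ, 0 ≤ t → ‖T t‖ ≤ M * Real.exp (w * t)) {z : ℂ} (hz : w < z.re) (x : E) :
    IntegrableOn (fun t : ℝ => Complex.exp (-z * t) • T |t| x) (Ioi 0) := by
  have hi : IntegrableOn (fun t : ℝ => M * ‖x‖ * Real.exp ((w - z.re) * t)) (Ioi 0) :=
    (integrableOn_exp_mul_Ioi (by linarith) 0).const_mul _
  refine Integrable.mono' hi ?_ ?_
  · have := hT.continuous_apply_abs hcontr x
    exact (Continuous.smul (by fun_prop) this).aestronglyMeasurable
  · refine (ae_restrict_iff' measurableSet_Ioi).2 (Eventually.of_forall fun t ht => ?_)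
    have ht' : (0 : ℝ) ≤ t := le_of_lt ht
    rw [norm_smul, Complex.norm_exp, abs_of_nonneg ht']
    have h1 := (T t).le_of_opNorm_le (hM t ht') x
    have h2 : (-z * (t : ℂ)).re = -z.re * t := by simp
    have h3 : Real.exp ((w - z.re) * t) = Real.exp (-z.re * t) * Real.exp (w * t) := by
      rw [← Real.exp_add]; ring_nf
    rw [h2, h3]
    nlinarith [mul_le_mul_of_nonneg_left h1 (Real.exp_pos (-z.re * t)).le]

/-- The Laplace transform of an orbit of the semigroup is the value of the resolvent. -/
theorem IsC0Semigroup.laplace_mem_domain [CompleteSpace E] (hT : IsC0Semigroup T)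
    (hgen : IsGenerator T L) (hcontr : ∀ t : ℝ, 0 ≤ t → ‖T t‖ ≤ 1) {M w : ℝ}
    (hM : ∀ t : ℝ, 0 ≤ t → ‖T t‖ ≤ M * Real.exp (w * t)) {z : ℂ} (hz : w < z.re) (x : E) :
    ∃ u : L.domain, (u : E) = ∫ t in Ioi (0 : ℝ), Complex.exp (-z * t) • T |t| x ∧
      z • (u : E) - L u = x := by
  set g : ℝ → E := fun t => Complex.exp (-z * t) • T |t| x with hg
  have hgi : IntegrableOn g (Ioi 0) := hT.integrableOn_laplace hcontr hM hz x
  have hgc : Continuous g :=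
    Continuous.smul (by fun_prop) (hT.continuous_apply_abs hcontr x)
  set J : E := ∫ t in Ioi (0 : ℝ), g t with hJ
  -- The semigroup law shifts the integral, so `T h J` becomes an explicit differentiable function
  -- of `h`; its derivative at `0` is the generator applied to `J`.
  have hTh : ∀ h : ℝ, 0 < h → T h J = Complex.exp (z * h) • (J - ∫ t in (0 : ℝ)..h, g t) := by
    intro h hh
    have hs : J - ∫ t in (0 : ℝ)..h, g t = ∫ t in Ioi h, g t := by
      rw [hJ, ← intervalIntegral.integral_interval_add_Ioi hgi
        (hgi.mono_set (Ioi_subset_Ioi hh.le)), add_sub_cancel_left]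
    rw [hs, ← setIntegral_Ioi_comp_add, ← integral_smul, hJ,
      ← (T h).integral_comp_comm hgi]
    refine setIntegral_congr_fun measurableSet_Ioi fun t ht => ?_
    have ht' : (0 : ℝ) ≤ t := le_of_lt ht
    simp only [hg, map_smul, smul_smul, ← Complex.exp_add]
    rw [abs_of_nonneg ht', abs_of_nonneg (by positivity : 0 ≤ t + h), add_comm t h,
      hT.map_add h t hh.le ht', mul_apply_eq_comp]
    congr 2
    push_cast
    ring
  have hd1 : HasDerivAt (fun h : ℝ => ∫ t in (0 : ℝ)..h, g t) x 0 := by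
    have := intervalIntegral.integral_hasDerivAt_right (hgc.intervalIntegrable 0 0)
      hgc.stronglyMeasurable.stronglyMeasurableAtFilter hgc.continuousAt
    simpa [hg, hT.map_zero] using this
  have hd2 : HasDerivAt (fun h : ℝ => Complex.exp (z * h)) z 0 := by
    have h1 : HasDerivAt (fun h : ℝ => z * (h : ℂ)) z 0 := by
      simpa using (Complex.ofRealCLM.hasDerivAt (x := (0 : ℝ))).const_mul z
    simpa using h1.cexp
  have hd3 : HasDerivAt
      (fun h : ℝ => Complex.exp (z * h) • (J - ∫ t in (0 : ℝ)..h, g t)) (z • J - x) 0 := by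
    have := hd2.smul (hd1.const_sub J)
    simp only [Complex.ofReal_zero, mul_zero, Complex.exp_zero, intervalIntegral.integral_same,
      sub_zero, one_smul, neg_add_eq_sub] at this
    exact this
  have hlim : Tendsto (fun t : ℝ => ((t : ℂ)⁻¹) • (T t J - J)) (𝓝[>] 0) (𝓝 (z • J - x)) := by
    refine hd3.tendsto_slope_zero_right.congr' ?_
    filter_upwards [self_mem_nhdsWithin] with h hh
    rw [zero_add, ← hTh h hh]
    simp only [Complex.ofReal_zero, mul_zero, Complex.exp_zero, intervalIntegral.integral_same,
      sub_zero, one_smul]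
    rw [← Complex.ofReal_inv, Complex.coe_smul]
  obtain ⟨hx, hL⟩ := (hgen J (z • J - x)).2 hlim
  exact ⟨⟨J, hx⟩, rfl, by rw [hL]; simp⟩

end Semigroup
end SecondOrder

/-! ### Square integrability of damped orbits. -/

namespace SecondOrder
open Filter Topology MeasureTheory FourierTransform Set

section DampedOrbit

variable {E : Type*} [NormedAddCommGroup E] [NormedSpace ℂ E] {T : ℝ → E →L[ℂ] E}
  {L : E →ₗ.[ℂ] E}

/-- The orbit `t ↦ exp (-w t) T t x` for `t > 0`, extended by zero to the real line. -/
noncomputable def dampedOrbit (T : ℝ → E →L[ℂ] E) (w : ℝ) (x : E) : ℝ → E :=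
  (Ioi (0 : ℝ)).indicator fun t => Complex.exp (-(w : ℂ) * t) • T |t| x

theorem norm_dampedOrbit {w t : ℝ} (ht : 0 < t) (x : E) :
    ‖dampedOrbit T w x t‖ = Real.exp (-w * t) * ‖T t x‖ := by
  rw [dampedOrbit, indicator_of_mem (by exact ht), norm_smul, Complex.norm_exp, abs_of_pos ht]
  simp

/-- With this normalisation, frequency `ξ` corresponds to the point `w + 2πiξ` of the line `Re z =
w`. -/
theorem fourier_dampedOrbit (w : ℝ) (x : E) (ξ : ℝ) :
    𝓕 (dampedOrbit T w x) ξ =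
      ∫ t in Ioi (0 : ℝ), Complex.exp (-((w : ℂ) + (2 * Real.pi * ξ : ℝ) * Complex.I) * t) •
        T |t| x := by
  rw [Real.fourier_real_eq_integral_exp_smul, ← integral_indicator measurableSet_Ioi]
  congr 1
  ext t
  by_cases ht : t ∈ Ioi (0 : ℝ)
  · rw [dampedOrbit, indicator_of_mem ht, indicator_of_mem ht, smul_smul, ← Complex.exp_add]
    congr 2
    push_cast
    ring
  · rw [dampedOrbit, indicator_of_notMem ht, indicator_of_notMem ht, smul_zero]

theorem IsC0Semigroup.integrable_dampedOrbit (hT : IsC0Semigroup T)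
    (hcontr : ∀ t : ℝ, 0 ≤ t → ‖T t‖ ≤ 1) {M v w : ℝ}
    (hM : ∀ t : ℝ, 0 ≤ t → ‖T t‖ ≤ M * Real.exp (v * t)) (hvw : v < w) (x : E) :
    Integrable (dampedOrbit T w x) :=
  (integrable_indicator_iff measurableSet_Ioi).2
    (hT.integrableOn_laplace hcontr hM (z := (w : ℂ)) (by simpa using hvw) x)

theorem IsC0Semigroup.memLp_dampedOrbit (hT : IsC0Semigroup T)
    (hcontr : ∀ t : ℝ, 0 ≤ t → ‖T t‖ ≤ 1) {M v w : ℝ}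
    (hM : ∀ t : ℝ, 0 ≤ t → ‖T t‖ ≤ M * Real.exp (v * t)) (hvw : v < w) (x : E) :
    MemLp (dampedOrbit T w x) 2 := by
  have hi := hT.integrable_dampedOrbit hcontr hM hvw x
  have hM0 : 0 ≤ M := by
    have := (norm_nonneg _).trans (hM 0 le_rfl)
    simpa using this
  refine (memLp_two_iff_integrable_sq_norm hi.1).2 ?_
  refine Integrable.mono' (hi.norm.const_mul (M * ‖x‖)) (hi.1.norm.pow 2)
    (Eventually.of_forall fun t => ?_)
  rw [Real.norm_of_nonneg (by positivity), pow_two]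
  refine mul_le_mul_of_nonneg_right ?_ (norm_nonneg _)
  by_cases ht : 0 < t
  · rw [norm_dampedOrbit ht]
    have h1 := (T t).le_of_opNorm_le (hM t ht.le) x
    have h2 : Real.exp (-w * t) * Real.exp (v * t) ≤ 1 := by
      rw [← Real.exp_add, Real.exp_le_one_iff]
      nlinarith
    calc Real.exp (-w * t) * ‖T t x‖ ≤ Real.exp (-w * t) * (M * Real.exp (v * t) * ‖x‖) := by
          gcongr
      _ = (Real.exp (-w * t) * Real.exp (v * t)) * (M * ‖x‖) := by ring
      _ ≤ 1 * (M * ‖x‖) := by gcongr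
      _ = M * ‖x‖ := one_mul _
  · rw [dampedOrbit, indicator_of_notMem (by exact ht), norm_zero]
    positivity

/-- At weight `1` contractivity alone gives the majorant `exp (-t) * ‖x‖`; this is the reference
norm for all smaller weights. -/
theorem eLpNorm_dampedOrbit_one_le (hcontr : ∀ t : ℝ, 0 ≤ t → ‖T t‖ ≤ 1) :
    ∃ D : ℝ, 0 ≤ D ∧ ∀ x : E, eLpNorm (dampedOrbit T 1 x) 2 ≤ ENNReal.ofReal (D * ‖x‖) := by
  set e : ℝ → ℝ := (Ioi (0 : ℝ)).indicator fun t => Real.exp (-t) with he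
  have hm : AEStronglyMeasurable e :=
    ((by fun_prop : Continuous fun t : ℝ => Real.exp (-t)).measurable.indicator
      measurableSet_Ioi).aestronglyMeasurable
  have hmem : MemLp e 2 := by
    refine (memLp_two_iff_integrable_sq hm).2 ?_
    have h2 : (fun t => e t ^ 2) = (Ioi (0 : ℝ)).indicator fun t => Real.exp (-2 * t) := by
      ext t
      by_cases ht : t ∈ Ioi (0 : ℝ)
      · rw [he, indicator_of_mem ht, indicator_of_mem ht, ← Real.exp_nat_mul]
        push_cast; ring_nf
      · rw [he, indicator_of_notMem ht, indicator_of_notMem ht]; simp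
    rw [h2]
    exact (integrable_indicator_iff measurableSet_Ioi).2
      (integrableOn_exp_mul_Ioi (by norm_num) 0)
  refine ⟨(eLpNorm e 2).toReal, ENNReal.toReal_nonneg, fun x => ?_⟩
  have h := eLpNorm_le_mul_eLpNorm_of_ae_le_mul (μ := volume) (f := dampedOrbit T 1 x) (g := e)
    (c := ‖x‖) (Eventually.of_forall fun t => ?_) 2
  · rwa [mul_comm, ENNReal.ofReal_mul (norm_nonneg _), ENNReal.ofReal_toReal hmem.2.ne]
  · by_cases ht : 0 < t
    · rw [norm_dampedOrbit ht, he, indicator_of_mem (by exact ht), Real.norm_of_nonneg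
        (Real.exp_pos _).le, mul_comm, neg_mul, one_mul]
      gcongr
      exact norm_apply_le_of_contraction hcontr ht.le x
    · rw [dampedOrbit, indicator_of_notMem (by exact ht), norm_zero]
      positivity

theorem ofReal_mul_sqrt_le_eLpNorm_dampedOrbit {w m a b : ℝ} {x : E} (hm : 0 ≤ m) (ha : 0 ≤ a)
    (hab : a ≤ b) (h : ∀ t ∈ Ioc a b, m ≤ Real.exp (-w * t) * ‖T t x‖) :
    ENNReal.ofReal (m * √(b - a)) ≤ eLpNorm (dampedOrbit T w x) 2 := by
  have h1 : eLpNorm ((Ioc a b).indicator fun _ => m) 2 (volume : Measure ℝ) =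
      ENNReal.ofReal (m * √(b - a)) := by
    rw [eLpNorm_indicator_const measurableSet_Ioc (by norm_num) (by norm_num), Real.volume_Ioc,
      Real.enorm_of_nonneg hm, ENNReal.ofReal_rpow_of_nonneg (sub_nonneg.2 hab) (by positivity),
      ← ENNReal.ofReal_mul hm, Real.sqrt_eq_rpow]
    norm_num
  rw [← h1]
  refine eLpNorm_mono fun t => ?_
  by_cases ht : t ∈ Ioc a b
  · rw [indicator_of_mem ht, Real.norm_of_nonneg hm, norm_dampedOrbit (ha.trans_lt ht.1)]
    exact h t ht
  · rw [indicator_of_notMem ht, norm_zero]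
    exact norm_nonneg _

end DampedOrbit

section GearhartPruss

variable {E : Type*} [NormedAddCommGroup E] [InnerProductSpace ℂ E] [CompleteSpace E]
  {T : ℝ → E →L[ℂ] E} {L : E →ₗ.[ℂ] E}

/-- A uniform lower bound for `z - L` on vertical lines compares the `L²` norms of the damped
orbits for different weights. -/
theorem IsC0Semigroup.eLpNorm_dampedOrbit_le (hT : IsC0Semigroup T) (hgen : IsGenerator T L)
    (hcontr : ∀ t : ℝ, 0 ≤ t → ‖T t‖ ≤ 1) {M v w c : ℝ} (hc : 0 < c)
    (hM : ∀ t : ℝ, 0 ≤ t → ‖T t‖ ≤ M * Real.exp (v * t)) (hvw : v < w) (hw : w ≤ 1)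
    (hLB : ∀ z : ℂ, z.re = w → ∀ u : L.domain, c * ‖(u : E)‖ ≤ ‖z • (u : E) - L u‖) (x : E) :
    eLpNorm (dampedOrbit T w x) 2 ≤
      ENNReal.ofReal (1 + (1 - w) / c) * eLpNorm (dampedOrbit T 1 x) 2 := by
  have hM1 : ∀ t : ℝ, 0 ≤ t → ‖T t‖ ≤ 1 * Real.exp (0 * t) := fun t ht => by
    simpa using hcontr t ht
  rw [← eLpNorm_fourier_eq (hT.integrable_dampedOrbit hcontr hM hvw x)
      (hT.memLp_dampedOrbit hcontr hM hvw x),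
    ← eLpNorm_fourier_eq (hT.integrable_dampedOrbit hcontr hM1 one_pos x)
      (hT.memLp_dampedOrbit hcontr hM1 one_pos x)]
  refine eLpNorm_le_mul_eLpNorm_of_ae_le_mul (Eventually.of_forall fun ξ => ?_) 2
  rw [fourier_dampedOrbit, fourier_dampedOrbit]
  set z : ℂ := (w : ℂ) + (2 * Real.pi * ξ : ℝ) * Complex.I with hz
  set z₁ : ℂ := ((1 : ℝ) : ℂ) + (2 * Real.pi * ξ : ℝ) * Complex.I with hz₁
  have hzre : z.re = w := by simp [hz]
  have hz₁re : z₁.re = 1 := by simp [hz₁]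
  obtain ⟨u, hu, hu'⟩ := hT.laplace_mem_domain hgen hcontr hM (z := z) (by rwa [hzre]) x
  obtain ⟨u₁, hu₁, hu₁'⟩ := hT.laplace_mem_domain hgen hcontr hM1 (z := z₁)
    (by rw [hz₁re]; exact one_pos) x
  rw [← hu, ← hu₁]
  have hzz : z₁ - z = ((1 - w : ℝ) : ℂ) := by rw [hz, hz₁]; push_cast; ring
  -- This is the resolvent identity. The factor `z₁ - z = 1 - w` does not depend on the frequency,
  -- so the comparison is pointwise with one constant.
  have h1 : z • ((u - u₁ : L.domain) : E) - L (u - u₁) = (z₁ - z) • (u₁ : E) := by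
    rw [LinearPMap.map_sub, Submodule.coe_sub, smul_sub, sub_smul]
    have : z • (u : E) = x + L u := by rw [← hu']; abel
    rw [this]
    have : L u₁ = z₁ • (u₁ : E) - x := by rw [← hu₁']; abel
    rw [this]
    abel
  have h2 := hLB z hzre (u - u₁)
  rw [h1, hzz, norm_smul, Complex.norm_real, Real.norm_of_nonneg (sub_nonneg.2 hw),
    Submodule.coe_sub] at h2
  have h3 : ‖(u : E)‖ ≤ ‖(u : E) - u₁‖ + ‖(u₁ : E)‖ := by
    simpa using norm_add_le ((u : E) - u₁) u₁
  have h4 : ‖(u : E) - u₁‖ ≤ (1 - w) / c * ‖(u₁ : E)‖ := by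
    rw [div_mul_eq_mul_div, le_div_iff₀ hc]
    linarith
  linarith

end GearhartPruss
end SecondOrder

/-! ### Datko's theorem and propagation of exponential bounds. -/

namespace SecondOrder
open Filter Topology MeasureTheory FourierTransform Set

section Datko

variable {E : Type*} [NormedAddCommGroup E] [NormedSpace ℂ E] {T : ℝ → E →L[ℂ] E}
  {L : E →ₗ.[ℂ] E}

theorem IsC0Semigroup.map_eq_apply_sub (hT : IsC0Semigroup T) {s t : ℝ} (hs : 0 ≤ s)
    (hst : s ≤ t) (x : E) : T t x = T (t - s) (T s x) := by
  rw [← mul_apply_eq_comp, ← hT.map_add (t - s) s (sub_nonneg.2 hst) hs, sub_add_cancel]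

/-- **Datko's theorem** with explicit constants: square integrability of the orbits of the
rescaled semigroup forces the norm below `1 / 2` after an explicit time. -/
theorem IsC0Semigroup.norm_le_half_of_eLpNorm_le (hT : IsC0Semigroup T)
    (hcontr : ∀ t : ℝ, 0 ≤ t → ‖T t‖ ≤ 1) {w κ C N τ : ℝ} (hκ : |w| ≤ κ) (hC : 1 ≤ C)
    (hCx : ∀ x : E, eLpNorm (dampedOrbit T w x) 2 ≤ ENNReal.ofReal (C * ‖x‖))
    (hN : N = Real.exp κ * C) (hτ : τ = (2 * N * C) ^ 2) :
    ‖T τ‖ ≤ 1 / 2 * Real.exp (w * τ) := by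
  have key : ∀ {m a b : ℝ} {x : E}, 0 ≤ m → 0 ≤ a → a ≤ b →
      (∀ t ∈ Ioc a b, m ≤ Real.exp (-w * t) * ‖T t x‖) → m * √(b - a) ≤ C * ‖x‖ :=
    fun {m a b x} hm ha hab h => (ENNReal.ofReal_le_ofReal_iff (by positivity)).1
      ((ofReal_mul_sqrt_le_eLpNorm_dampedOrbit hm ha hab h).trans (hCx x))
  have hw := abs_le.1 hκ
  have hκ0 : 0 ≤ κ := (abs_nonneg w).trans hκ
  have hC0 : 0 < C := one_pos.trans_le hC
  have hexp : ∀ t ∈ Icc (0 : ℝ) 1, Real.exp (-w * t) ≤ Real.exp κ := fun t ht =>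
    Real.exp_le_exp.2 (by nlinarith [ht.1, ht.2])
  have hN1 : Real.exp κ ≤ N := by rw [hN]; exact le_mul_of_one_le_right (Real.exp_pos κ).le hC
  have hN0 : 0 < N := (Real.exp_pos κ).trans_le hN1
  have bounded : ∀ t : ℝ, 0 ≤ t → ∀ x : E, Real.exp (-w * t) * ‖T t x‖ ≤ N * ‖x‖ := by
    intro t ht x
    by_cases ht1 : t ≤ 1
    · exact mul_le_mul ((hexp t ⟨ht, ht1⟩).trans hN1) (norm_apply_le_of_contraction hcontr ht x)
        (norm_nonneg _) hN0.le
    · have ht1 : 1 ≤ t := le_of_not_ge ht1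
      -- Norms of orbits are nonincreasing, so the value at `t` is a lower bound on `(t - 1, t]`;
      -- the factor `exp (-κ)` pays for the variation of the weight over unit time.
      have h := key (m := Real.exp (-κ) * (Real.exp (-w * t) * ‖T t x‖)) (a := t - 1) (b := t)
        (x := x) (by positivity) (by linarith) (by linarith) fun s hs => by
          have hs0 : 0 ≤ s := by linarith [hs.1]
          have h1 : ‖T t x‖ ≤ ‖T s x‖ := by
            rw [hT.map_eq_apply_sub hs0 hs.2]
            exact norm_apply_le_of_contraction hcontr (sub_nonneg.2 hs.2) _
          have h2 : Real.exp (-κ) * Real.exp (-w * t) ≤ Real.exp (-w * s) := by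
            rw [← Real.exp_add]
            exact Real.exp_le_exp.2 (by nlinarith [hs.1, hs.2])
          rw [← mul_assoc]
          gcongr
      rw [sub_sub_cancel, Real.sqrt_one, mul_one] at h
      calc Real.exp (-w * t) * ‖T t x‖
          = Real.exp κ * (Real.exp (-κ) * (Real.exp (-w * t) * ‖T t x‖)) := by
            rw [← mul_assoc (Real.exp κ), ← Real.exp_add]; simp
        _ ≤ Real.exp κ * (C * ‖x‖) := by gcongr
        _ = N * ‖x‖ := by rw [hN]; ring
  have hτ0 : 0 ≤ τ := by rw [hτ]; positivity
  refine (T τ).opNorm_le_bound (by positivity) fun x => ?_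
  -- The uniform bound now works backwards from `τ` over the whole of `(0, τ]`. Since `√τ = 2 * N *
  -- C`, the length of the interval yields the factor `1 / 2`.
  have h := key (m := N⁻¹ * (Real.exp (-w * τ) * ‖T τ x‖)) (a := 0) (b := τ) (x := x)
    (by positivity) le_rfl hτ0 fun s hs => by
      rw [inv_mul_le_iff₀ hN0]
      have h1 := bounded (τ - s) (sub_nonneg.2 hs.2) (T s x)
      rw [← hT.map_eq_apply_sub hs.1.le hs.2] at h1
      calc Real.exp (-w * τ) * ‖T τ x‖
          = Real.exp (-w * s) * (Real.exp (-w * (τ - s)) * ‖T τ x‖) := by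
            rw [← mul_assoc, ← Real.exp_add]; ring_nf
        _ ≤ Real.exp (-w * s) * (N * ‖T s x‖) := by gcongr
        _ = N * (Real.exp (-w * s) * ‖T s x‖) := by ring
  rw [sub_zero, hτ, Real.sqrt_sq (by positivity), ← hτ] at h
  have h2 : 2 * C * (Real.exp (-w * τ) * ‖T τ x‖) ≤ C * ‖x‖ := by
    calc 2 * C * (Real.exp (-w * τ) * ‖T τ x‖)
        = N⁻¹ * (Real.exp (-w * τ) * ‖T τ x‖) * (2 * N * C) := by field_simp
      _ ≤ C * ‖x‖ := h
  have h3 : Real.exp (-w * τ) * ‖T τ x‖ ≤ 1 / 2 * ‖x‖ := by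
    have : C * (2 * (Real.exp (-w * τ) * ‖T τ x‖)) ≤ C * ‖x‖ := by linarith
    linarith [le_of_mul_le_mul_left this hC0]
  calc ‖T τ x‖ = Real.exp (w * τ) * (Real.exp (-w * τ) * ‖T τ x‖) := by
        rw [← mul_assoc, ← Real.exp_add]; simp
    _ ≤ Real.exp (w * τ) * (1 / 2 * ‖x‖) := by gcongr
    _ = 1 / 2 * Real.exp (w * τ) * ‖x‖ := by ring

/-- An exponential bound at one positive time propagates to all times. -/
theorem IsC0Semigroup.exists_norm_le_exp_of_norm_le (hT : IsC0Semigroup T)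
    (hcontr : ∀ t : ℝ, 0 ≤ t → ‖T t‖ ≤ 1) {ν τ : ℝ} (hτ : 0 < τ)
    (h : ‖T τ‖ ≤ Real.exp (ν * τ)) :
    ∃ M : ℝ, 1 ≤ M ∧ ∀ t : ℝ, 0 ≤ t → ‖T t‖ ≤ M * Real.exp (ν * t) := by
  have hn : ∀ n : ℕ, ∀ r : ℝ, 0 ≤ r → ‖T (n * τ + r)‖ ≤ Real.exp (ν * (n * τ)) := by
    intro n
    induction n with
    | zero => intro r hr; simpa using hcontr r hr
    | succ n ih =>
      intro r hr
      have : ((n + 1 : ℕ) : ℝ) * τ + r = τ + (n * τ + r) := by push_cast; ring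
      rw [this, hT.map_add _ _ hτ.le (by positivity)]
      calc ‖T τ * T (n * τ + r)‖ ≤ ‖T τ‖ * ‖T (n * τ + r)‖ := norm_mul_le _ _
        _ ≤ Real.exp (ν * τ) * Real.exp (ν * (n * τ)) := by gcongr; exact ih r hr
        _ = Real.exp (ν * ((n + 1 : ℕ) * τ)) := by rw [← Real.exp_add]; push_cast; ring_nf
  -- The constant absorbs the remainder `t - n * τ < τ` for either sign of `ν`.
  refine ⟨Real.exp (|ν| * τ), Real.one_le_exp (by positivity), fun t ht => ?_⟩
  set n : ℕ := ⌊t / τ⌋₊ with hnd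
  have h1 : (n : ℝ) * τ ≤ t := (le_div_iff₀ hτ).1 (Nat.floor_le (by positivity))
  have h2 : t < (n + 1) * τ := (div_lt_iff₀ hτ).1 (Nat.lt_floor_add_one _)
  have h3 := hn n (t - n * τ) (by linarith)
  rw [add_sub_cancel] at h3
  refine h3.trans ?_
  rw [← Real.exp_add]
  refine Real.exp_le_exp.2 ?_
  have h4 := neg_abs_le ν
  nlinarith [abs_nonneg ν, neg_abs_le ν]

end Datko

/-! ### The Gearhart–Prüss theorem. -/

section GearhartPruss

variable {E : Type*} [NormedAddCommGroup E] [InnerProductSpace ℂ E] [CompleteSpace E]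
  {T : ℝ → E →L[ℂ] E} {L : E →ₗ.[ℂ] E}

/-- **Gearhart–Prüss theorem** for contraction semigroups on a Hilbert space: a uniform lower
bound for `z - L` on a closed right half plane gives the corresponding exponential bound for the
semigroup. -/
theorem IsC0Semigroup.exists_norm_le_exp_of_lower_bound (hT : IsC0Semigroup T)
    (hgen : IsGenerator T L) (hcontr : ∀ t : ℝ, 0 ≤ t → ‖T t‖ ≤ 1) {ω c : ℝ} (hc : 0 < c)
    (hLB : ∀ z : ℂ, ω ≤ z.re → ∀ u : L.domain, c * ‖(u : E)‖ ≤ ‖z • (u : E) - L u‖) :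
    ∃ M : ℝ, 1 ≤ M ∧ ∀ t : ℝ, 0 ≤ t → ‖T t‖ ≤ M * Real.exp (ω * t) := by
  set S : Set ℝ := {w | ∃ M : ℝ, 1 ≤ M ∧ ∀ t : ℝ, 0 ≤ t → ‖T t‖ ≤ M * Real.exp (w * t)} with hS
  have hmono : ∀ {v w : ℝ}, v ∈ S → v ≤ w → w ∈ S := by
    rintro v w ⟨M, hM1, hM⟩ hvw
    refine ⟨M, hM1, fun t ht => (hM t ht).trans ?_⟩
    gcongr
  have h0 : (0 : ℝ) ∈ S := ⟨1, le_rfl, fun t ht => by simpa using hcontr t ht⟩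
  by_contra hω
  have hω' : ω ∉ S := hω
  have hlow : ω ∈ lowerBounds S := fun v hv => le_of_not_ge fun h => hω' (hmono hv h)
  have hbdd : BddBelow S := ⟨ω, hlow⟩
  set w₀ := sInf S with hw₀
  have hω0 : ω ≤ w₀ := le_csInf ⟨0, h0⟩ hlow
  have hw₀0 : w₀ ≤ 0 := csInf_le hbdd h0
  obtain ⟨D, hD0, hD⟩ := eLpNorm_dampedOrbit_one_le hcontr
  -- Using `ω` in place of the weight `w ≥ ω` fixes `C`, `N` and `τ` before `w` is chosen, so the
  -- gain `δ` is independent of `w`.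
  set K : ℝ := 1 + (1 - ω) / c with hK
  have hK0 : 0 ≤ K := by
    have : 0 ≤ (1 - ω) / c := div_nonneg (by linarith) hc.le
    linarith
  set C : ℝ := max 1 (K * D) with hC
  set κ : ℝ := |ω| + 1 with hκ
  set N : ℝ := Real.exp κ * C with hN
  set τ : ℝ := (2 * N * C) ^ 2 with hτ
  have hC1 : 1 ≤ C := le_max_left _ _
  have hτ0 : 0 < τ := by positivity
  set δ : ℝ := Real.log 2 / τ with hδ
  have hδ0 : 0 < δ := div_pos (Real.log_pos one_lt_two) hτ0
  -- Less than `δ` above the infimum, so the gain `δ` leads strictly below it, a contradiction; the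
  -- cap by `1` keeps `w ≤ 1` and `|w| ≤ κ`.
  set w : ℝ := w₀ + min δ 1 / 2 with hw
  have hmin : 0 < min δ 1 := lt_min hδ0 one_pos
  obtain ⟨v, ⟨M, -, hM⟩, hvw⟩ := exists_lt_of_csInf_lt ⟨0, h0⟩
    (show sInf S < w by rw [← hw₀, hw]; linarith)
  have hwω : ω ≤ w := by rw [hw]; linarith
  have hw1 : w ≤ 1 := by rw [hw]; linarith [min_le_right δ 1]
  have hest : ∀ x : E, eLpNorm (dampedOrbit T w x) 2 ≤ ENNReal.ofReal (C * ‖x‖) := by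
    intro x
    refine (hT.eLpNorm_dampedOrbit_le hgen hcontr hc hM hvw hw1
      (fun z hz => hLB z (by rw [hz]; exact hwω)) x).trans ?_
    refine (mul_le_mul_right (hD x) _).trans ?_
    have h1 : 0 ≤ 1 + (1 - w) / c := by
      have : 0 ≤ (1 - w) / c := div_nonneg (by linarith) hc.le
      linarith
    rw [← ENNReal.ofReal_mul h1]
    refine ENNReal.ofReal_le_ofReal ?_
    rw [← mul_assoc]
    refine mul_le_mul_of_nonneg_right (le_trans ?_ (le_max_right _ _)) (norm_nonneg _)
    refine mul_le_mul_of_nonneg_right ?_ hD0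
    rw [hK]
    gcongr
  have hwκ : |w| ≤ κ := by
    rw [hκ, abs_le]
    constructor <;> linarith [neg_abs_le ω, abs_nonneg ω]
  have hhalf := hT.norm_le_half_of_eLpNorm_le hcontr hwκ hC1 hest hN hτ
  have hexp : 1 / 2 * Real.exp (w * τ) = Real.exp ((w - δ) * τ) := by
    have : (w - δ) * τ = -Real.log 2 + w * τ := by
      rw [hδ, sub_mul, div_mul_cancel₀ _ hτ0.ne']; ring
    rw [this, Real.exp_add, Real.exp_neg, Real.exp_log two_pos, one_div]
  have hmem : w - δ ∈ S := hT.exists_norm_le_exp_of_norm_le hcontr hτ0 (hhalf.trans_eq hexp)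
  have := csInf_le hbdd hmem
  have h5 := min_le_left δ 1
  rw [← hw₀, hw] at this
  linarith

end GearhartPruss
end SecondOrder

/-! ### Lower bounds and the resolvent set. -/

namespace SecondOrder
open Filter Topology Set

section Resolvent

variable {E : Type*} [NormedAddCommGroup E] [NormedSpace ℂ E] {L : E →ₗ.[ℂ] E}

/-- The estimate `c ‖u‖ ≤ ‖(z - L) u‖` on the domain of `L`. -/
def HasLowerBound (L : E →ₗ.[ℂ] E) (z : ℂ) (c : ℝ) : Prop :=
  ∀ u : L.domain, c * ‖(u : E)‖ ≤ ‖z • (u : E) - L u‖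

theorem HasLowerBound.mono {z : ℂ} {c c' : ℝ} (h : HasLowerBound L z c) (hc : c' ≤ c) :
    HasLowerBound L z c' := fun u =>
  (mul_le_mul_of_nonneg_right hc (norm_nonneg _)).trans (h u)

theorem HasLowerBound.perturb {z z' : ℂ} {c : ℝ} (h : HasLowerBound L z c) :
    HasLowerBound L z' (c - ‖z' - z‖) := by
  intro u
  have h1 : z • (u : E) - L u = (z' • (u : E) - L u) - (z' - z) • (u : E) := by
    rw [sub_smul]; abel
  have h2 := h u
  have h3 := norm_sub_le (z' • (u : E) - L u) ((z' - z) • (u : E))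
  rw [h1] at h2
  rw [norm_smul] at h3
  linarith

theorem exists_hasLowerBound_of_mem_resolventSet {z : ℂ} (hz : z ∈ resolventSet L) :
    ∃ c : ℝ, 0 < c ∧ HasLowerBound L z c := by
  obtain ⟨R, -, hR⟩ := hz
  refine ⟨(‖R‖ + 1)⁻¹, by positivity, fun u => ?_⟩
  rw [inv_mul_le_iff₀ (by positivity)]
  have h := R.le_opNorm (z • (u : E) - L u)
  rw [hR u] at h
  linarith [norm_nonneg (z • (u : E) - L u)]

theorem HasLowerBound.mem_resolventSet {z : ℂ} {c : ℝ} (hc : 0 < c) (h : HasLowerBound L z c)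
    (hs : ∀ x : E, ∃ u : L.domain, z • (u : E) - L u = x) : z ∈ resolventSet L := by
  have hinj : ∀ u v : L.domain, z • (u : E) - L u = z • (v : E) - L v → u = v := by
    intro u v huv
    have h1 := h (u - v)
    have h2 : z • ((u - v : L.domain) : E) - L (u - v) = 0 := by
      rw [LinearPMap.map_sub, Submodule.coe_sub, smul_sub, sub_sub_sub_comm, huv, sub_self]
    rw [h2, norm_zero] at h1
    have h3 : ‖((u - v : L.domain) : E)‖ = 0 := by
      nlinarith [norm_nonneg ((u - v : L.domain) : E)]
    exact sub_eq_zero.1 (Subtype.ext (norm_eq_zero.1 h3))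
  choose g hg using hs
  refine ⟨LinearMap.mkContinuous
    { toFun := fun x => (g x : E)
      map_add' := fun x y => ?_
      map_smul' := fun a x => ?_ } c⁻¹ fun x => ?_, fun x => ⟨(g x).2, hg x⟩, fun u => ?_⟩
  · rw [← Submodule.coe_add]
    refine congrArg _ (hinj _ _ ?_)
    rw [hg, LinearPMap.map_add, Submodule.coe_add, smul_add, add_sub_add_comm, hg, hg]
  · rw [RingHom.id_apply, ← Submodule.coe_smul]
    refine congrArg _ (hinj _ _ ?_)
    rw [hg, LinearPMap.map_smul, Submodule.coe_smul, smul_comm, ← smul_sub, hg]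
  · have := h (g x)
    rw [hg] at this
    change ‖(g x : E)‖ ≤ c⁻¹ * ‖x‖
    rwa [← div_eq_inv_mul, le_div_iff₀' hc]
  · exact congrArg Subtype.val (hinj _ _ (hg _))

theorem exists_hasLowerBound_of_isCompact {s : Set ℂ} (hs : IsCompact s)
    (hsub : s ⊆ resolventSet L) : ∃ c : ℝ, 0 < c ∧ ∀ z ∈ s, HasLowerBound L z c := by
  refine hs.induction_on (p := fun t => ∃ c : ℝ, 0 < c ∧ ∀ z ∈ t, HasLowerBound L z c)
    ⟨1, one_pos, fun z hz => hz.elim⟩ ?_ ?_ ?_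
  · rintro t t' htt' ⟨c, hc, h⟩
    exact ⟨c, hc, fun z hz => h z (htt' hz)⟩
  · rintro t t' ⟨c, hc, h⟩ ⟨c', hc', h'⟩
    refine ⟨min c c', lt_min hc hc', ?_⟩
    rintro z (hz | hz)
    · exact (h z hz).mono (min_le_left _ _)
    · exact (h' z hz).mono (min_le_right _ _)
  · intro z hz
    obtain ⟨c, hc, h⟩ := exists_hasLowerBound_of_mem_resolventSet (hsub hz)
    refine ⟨Metric.ball z (c / 2), mem_nhdsWithin_of_mem_nhds (Metric.ball_mem_nhds z
      (by positivity)), c / 2, by positivity, fun z' hz' => (h.perturb (z' := z')).mono ?_⟩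
    rw [Metric.mem_ball, dist_eq_norm] at hz'
    linarith

theorem mem_resolventSet_of_spectralBound_lt {z : ℂ} (h : spectralBound L < (z.re : EReal)) :
    z ∈ resolventSet L := by
  by_contra hz
  exact absurd (le_iSup₂_of_le (f := fun (z : ℂ) (_ : z ∈ spectralSet L) => ((z.re : ℝ) : EReal))
    z hz le_rfl) (not_le.2 h)

theorem spectralBound_le {r : ℝ} (h : ∀ z : ℂ, r < z.re → z ∈ resolventSet L) :
    spectralBound L ≤ (r : EReal) :=
  iSup₂_le fun z hz => EReal.coe_le_coe_iff.2 (le_of_not_gt fun hr => hz (h z hr))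

variable [CompleteSpace E]

/-- The lower bound at `z` survives at `z'` with constant above `c / 2`, so the resolvent at `z'`
has norm at most `2 / c` and the Neumann series reaches `z`. Only a right inverse is needed, since
the lower bound gives injectivity. -/
theorem HasLowerBound.mem_resolventSet_of_near {z z' : ℂ} {c : ℝ} (h : HasLowerBound L z c)
    (hz' : z' ∈ resolventSet L) (hd : ‖z - z'‖ < c / 2) : z ∈ resolventSet L := by
  have hc : 0 < c := by linarith [norm_nonneg (z - z')]
  refine h.mem_resolventSet hc fun x => ?_
  obtain ⟨R, hR, -⟩ := hz'
  have hRn : ‖R‖ ≤ 2 / c := by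
    refine R.opNorm_le_bound (by positivity) fun w => ?_
    obtain ⟨hw, hw'⟩ := hR w
    have h1 := (h.perturb (z' := z')) ⟨R w, hw⟩
    rw [hw', norm_sub_rev] at h1
    rw [div_mul_eq_mul_div, le_div_iff₀ hc]
    nlinarith [norm_nonneg (R w)]
  have hX : ‖(z' - z) • R‖ < 1 := by
    rw [norm_smul, norm_sub_rev]
    calc ‖z - z'‖ * ‖R‖ ≤ ‖z - z'‖ * (2 / c) := by gcongr
      _ < c / 2 * (2 / c) := by gcongr
      _ = 1 := by field_simp
  obtain ⟨Y, hY⟩ := (isUnit_one_sub_of_norm_lt_one hX).exists_right_inv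
  obtain ⟨hw, hw'⟩ := hR (Y x)
  refine ⟨⟨R (Y x), hw⟩, ?_⟩
  have h1 := DFunLike.congr_fun hY x
  have h2 : Y x - (z' - z) • R (Y x) = x := h1
  calc z • R (Y x) - L ⟨R (Y x), hw⟩
      = (z' • R (Y x) - L ⟨R (Y x), hw⟩) - (z' - z) • R (Y x) := by rw [sub_smul]; abel
    _ = x := by rw [hw', h2]

theorem isOpen_resolventSet : IsOpen (resolventSet L) := by
  rw [Metric.isOpen_iff]
  intro z hz
  obtain ⟨c, hc, h⟩ := exists_hasLowerBound_of_mem_resolventSet hz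
  -- At distance below `c / 4` the constant stays above `3c / 4`, whose half still exceeds the
  -- distance.
  refine ⟨c / 4, by positivity, fun z' hz' => ?_⟩
  rw [Metric.mem_ball, dist_eq_norm] at hz'
  exact (h.perturb (z' := z')).mem_resolventSet_of_near hz (by linarith)

theorem HasLowerBound.mem_resolventSet_of_mem_closure {z : ℂ} {c : ℝ} (hc : 0 < c)
    (h : HasLowerBound L z c) (hz : z ∈ closure (resolventSet L)) : z ∈ resolventSet L := by
  obtain ⟨z', hz', hd⟩ := Metric.mem_closure_iff.1 hz (c / 2) (by positivity)
  exact h.mem_resolventSet_of_near hz' (by rwa [← dist_eq_norm])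

/-- Lower bounds propagate membership in the resolvent set along connected sets. -/
theorem subset_resolventSet_of_hasLowerBound {s : Set ℂ} (hs : IsPreconnected s)
    (hne : (s ∩ resolventSet L).Nonempty)
    (h : ∀ z ∈ s, ∃ c : ℝ, 0 < c ∧ HasLowerBound L z c) : s ⊆ resolventSet L :=
  hs.subset_of_closure_inter_subset isOpen_resolventSet hne fun z hz =>
    let ⟨_, hc, hLB⟩ := h z hz.2
    hLB.mem_resolventSet_of_mem_closure hc hz.1

theorem IsC0Semigroup.mem_resolventSet {T : ℝ → E →L[ℂ] E} (hT : IsC0Semigroup T)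
    (hgen : IsGenerator T L) (hcontr : ∀ t : ℝ, 0 ≤ t → ‖T t‖ ≤ 1) {z : ℂ} (hz : 0 < z.re)
    {c : ℝ} (hc : 0 < c) (h : HasLowerBound L z c) : z ∈ resolventSet L :=
  h.mem_resolventSet hc fun x =>
    let ⟨u, _, hu⟩ := hT.laplace_mem_domain hgen hcontr (M := 1) (w := 0)
      (fun t ht => by simpa using hcontr t ht) hz x
    ⟨u, hu⟩

end Resolvent
end SecondOrder

/-! ### Energy estimates for the operator matrix. -/

namespace SecondOrder
open Filter Topology Set

section Wave

variable {H : Type*} [NormedAddCommGroup H] [InnerProductSpace ℂ H] [CompleteSpace H]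
  {A B : H →ₗ.[ℂ] H} {hA : IsStrictlyPositive A}

theorem IsStrictlyPositive.inner_invSqrt (hA : IsStrictlyPositive A) (x y : H) :
    inner ℂ x (hA.invSqrt y) = inner ℂ (hA.invSqrt x) y := by
  have h : (0 : H →L[ℂ] H) ≤ hA.invSqrt := CFC.sqrt_nonneg _
  rw [ContinuousLinearMap.nonneg_iff_isPositive] at h
  exact (h.isSymmetric x y).symm

theorem IsStrictlyPositive.invSqrt_apply (hA : IsStrictlyPositive A) (u : H)
    (hu : u ∈ A.domain) (hu' : u ∈ hA.sqrt.domain) :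
    hA.invSqrt (A ⟨u, hu⟩) = hA.sqrt ⟨u, hu'⟩ :=
  hA.invSqrt_injective (by rw [hA.invSqrt_invSqrt, hA.inv_apply, hA.invSqrt_sqrt])

theorem EnergySpace.invSqrt_root (u : EnergySpace hA) :
    hA.invSqrt (EnergySpace.root hA u) = EnergySpace.incl hA u := hA.invSqrt_sqrt u

theorem EnergySpace.invSqrt_apply (u : EnergySpace hA) (hu : EnergySpace.incl hA u ∈ A.domain) :
    hA.invSqrt (A ⟨EnergySpace.incl hA u, hu⟩) = EnergySpace.root hA u :=
  hA.invSqrt_apply _ hu u.2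

theorem EnergySpace.inner_def (u v : EnergySpace hA) :
    inner ℂ u v = inner ℂ (EnergySpace.root hA u) (EnergySpace.root hA v) := rfl

theorem EnergySpace.inner_apply (u v : EnergySpace hA)
    (hu : EnergySpace.incl hA u ∈ A.domain) :
    inner ℂ (A ⟨EnergySpace.incl hA u, hu⟩) (EnergySpace.incl hA v) = inner ℂ u v := by
  rw [← EnergySpace.invSqrt_root v, hA.inner_invSqrt, EnergySpace.invSqrt_apply,
    EnergySpace.inner_def]

theorem waveOperator_residual_fst (z : ℂ) (y : (waveOperator hA B).domain) :
    (z • (y : StateSpace hA) - waveOperator hA B y).fst =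
      z • y.1.fst - EnergySpace.mk hA y.1.snd y.2.2.1 := rfl

theorem waveOperator_residual_snd (z : ℂ) (y : (waveOperator hA B).domain) :
    (z • (y : StateSpace hA) - waveOperator hA B y).snd =
      z • y.1.snd + A ⟨EnergySpace.incl hA y.1.fst, y.2.1⟩ - B ⟨y.1.snd, y.2.2.2⟩ := by
  change z • y.1.snd - (-A ⟨EnergySpace.incl hA y.1.fst, y.2.1⟩ + B ⟨y.1.snd, y.2.2.2⟩) = _
  abel

/-- The energy identity for the resolvent equation of the operator matrix. -/
theorem inner_waveOperator_residual (z : ℂ) (y : (waveOperator hA B).domain) :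
    inner ℂ (z • (y : StateSpace hA) - waveOperator hA B y) (y : StateSpace hA) =
      (starRingEnd ℂ) z * (‖y.1.fst‖ ^ 2 + ‖y.1.snd‖ ^ 2 : ℝ) +
        (inner ℂ y.1.fst (EnergySpace.mk hA y.1.snd y.2.2.1) -
          inner ℂ (EnergySpace.mk hA y.1.snd y.2.2.1) y.1.fst) -
        inner ℂ (B ⟨y.1.snd, y.2.2.2⟩) y.1.snd := by
  have h : inner ℂ (A ⟨EnergySpace.incl hA y.1.fst, y.2.1⟩) y.1.snd =
      inner ℂ y.1.fst (EnergySpace.mk hA y.1.snd y.2.2.1) :=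
    EnergySpace.inner_apply _ (EnergySpace.mk hA y.1.snd y.2.2.1) _
  rw [WithLp.prod_inner_apply]
  change inner ℂ (z • (y : StateSpace hA) - waveOperator hA B y).fst y.1.fst +
    inner ℂ (z • (y : StateSpace hA) - waveOperator hA B y).snd y.1.snd = _
  rw [waveOperator_residual_fst, waveOperator_residual_snd, inner_sub_left, inner_sub_left,
    inner_add_left, inner_smul_left, inner_smul_left, h, inner_self_eq_norm_sq_to_K,
    inner_self_eq_norm_sq_to_K]
  push_cast
  simp only [Complex.coe_algebraMap]
  ring

theorem StateSpace.norm_sq (y : StateSpace hA) : ‖y‖ ^ 2 = ‖y.fst‖ ^ 2 + ‖y.snd‖ ^ 2 :=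
  WithLp.prod_norm_sq_eq_of_L2 y

/-- Real part of the energy identity: the cross terms are conjugate, so their difference drops out.
-/
theorem re_mul_norm_sq_add_le (z : ℂ) (y : (waveOperator hA B).domain) :
    z.re * ‖(y : StateSpace hA)‖ ^ 2 - (inner ℂ (B ⟨y.1.snd, y.2.2.2⟩) y.1.snd).re ≤
      ‖z • (y : StateSpace hA) - waveOperator hA B y‖ * ‖(y : StateSpace hA)‖ := by
  have h := congrArg Complex.re (inner_waveOperator_residual z y)
  have h1 := (Complex.re_le_norm _).trans
    (norm_inner_le_norm (𝕜 := ℂ) (z • (y : StateSpace hA) - waveOperator hA B y)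
      (y : StateSpace hA))
  rw [h] at h1
  have h2 : (inner ℂ y.1.fst (EnergySpace.mk hA y.1.snd y.2.2.1)).re =
      (inner ℂ (EnergySpace.mk hA y.1.snd y.2.2.1) y.1.fst).re := inner_re_symm (𝕜 := ℂ) _ _
  rw [StateSpace.norm_sq (y : StateSpace hA)]
  simp only [Complex.sub_re, Complex.add_re, Complex.re_mul_ofReal, Complex.conj_re, h2] at h1
  linarith

/-- Imaginary part of the energy identity. Substituting `v = z u - F.fst` into the cross terms
produces `2 Im z ‖u‖²`, which turns the sum of the two energies into their difference. The factor
`3` counts one pairing with `F` and two with `F.fst`. -/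
theorem abs_im_mul_le (z : ℂ) (y : (waveOperator hA B).domain) :
    |z.im| * |‖y.1.fst‖ ^ 2 - ‖y.1.snd‖ ^ 2| ≤
      3 * (‖z • (y : StateSpace hA) - waveOperator hA B y‖ * ‖(y : StateSpace hA)‖) +
        |(inner ℂ (B ⟨y.1.snd, y.2.2.2⟩) y.1.snd).im| := by
  set F := z • (y : StateSpace hA) - waveOperator hA B y with hF
  set v := EnergySpace.mk hA y.1.snd y.2.2.1 with hv
  have h := congrArg Complex.im (inner_waveOperator_residual z y)
  rw [← hF, ← hv] at h
  have h1 := (Complex.abs_im_le_norm _).trans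
    (norm_inner_le_norm (𝕜 := ℂ) F (y : StateSpace hA))
  have h2 : (inner ℂ v y.1.fst).im = -(inner ℂ y.1.fst v).im := inner_im_symm (𝕜 := ℂ) _ _
  have h3 : v = z • y.1.fst - F.fst := by
    rw [hF, waveOperator_residual_fst, sub_sub_cancel]
  have h4 : (inner ℂ y.1.fst v).im = z.im * ‖y.1.fst‖ ^ 2 - (inner ℂ y.1.fst F.fst).im := by
    have h5 : inner ℂ y.1.fst y.1.fst = ((‖y.1.fst‖ ^ 2 : ℝ) : ℂ) := by
      rw [inner_self_eq_norm_sq_to_K]; push_cast; rfl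
    rw [h3, inner_sub_right, inner_smul_right, h5, Complex.sub_im, Complex.im_mul_ofReal]
  have h5 : ‖y.1.fst‖ ≤ ‖(y : StateSpace hA)‖ :=
    abs_le_of_sq_le_sq' (by rw [StateSpace.norm_sq]; nlinarith [sq_nonneg ‖y.1.snd‖])
      (norm_nonneg _) |>.2
  have h6 : ‖F.fst‖ ≤ ‖F‖ :=
    abs_le_of_sq_le_sq' (by rw [StateSpace.norm_sq]; nlinarith [sq_nonneg ‖F.snd‖])
      (norm_nonneg _) |>.2
  have h7 : |(inner ℂ y.1.fst F.fst).im| ≤ ‖F‖ * ‖(y : StateSpace hA)‖ :=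
    ((Complex.abs_im_le_norm _).trans (norm_inner_le_norm _ _)).trans
      (by rw [mul_comm]; gcongr)
  simp only [Complex.sub_im, Complex.add_im, Complex.im_mul_ofReal, Complex.conj_im, h2, h4] at h
  rw [← abs_mul]
  have h8 : z.im * (‖y.1.fst‖ ^ 2 - ‖y.1.snd‖ ^ 2) = (inner ℂ F (y : StateSpace hA)).im +
      2 * (inner ℂ y.1.fst F.fst).im + (inner ℂ (B ⟨y.1.snd, y.2.2.2⟩) y.1.snd).im := by
    linarith
  rw [h8]
  refine (abs_add_three _ _ _).trans ?_
  rw [abs_mul, abs_two]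
  linarith

variable {γ α : ℝ}

theorem waveOperator_hasLowerBound_re
    (hdiss : ∀ v : B.domain, (inner ℂ (B v) (v : H)).re ≤ -2 * α * ‖(v : H)‖ ^ 2) (hα : 0 < α)
    (z : ℂ) : HasLowerBound (waveOperator hA B) z z.re := by
  intro y
  have h := re_mul_norm_sq_add_le z y
  have h1 := hdiss ⟨y.1.snd, y.2.2.2⟩
  have h2 : 0 ≤ α * ‖y.1.snd‖ ^ 2 := by positivity
  rcases (norm_nonneg (y : StateSpace hA)).eq_or_lt with h0 | h0
  · rw [← h0, mul_zero]; exact norm_nonneg _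
  · refine le_of_mul_le_mul_right ?_ h0
    simp only at h1
    nlinarith

theorem waveOperator_hasLowerBound_of_im_large (hγ : 0 ≤ γ) (hα : 0 < α)
    (hsector : ∀ v : B.domain,
      γ * (inner ℂ (B v) (v : H)).re ≤ -|(inner ℂ (B v) (v : H)).im|)
    (hdiss : ∀ v : B.domain, (inner ℂ (B v) (v : H)).re ≤ -2 * α * ‖(v : H)‖ ^ 2)
    {ε : ℝ} (hε : 0 < ε) :
    ∃ r : ℝ, 0 < r ∧ ∀ z : ℂ, -α + ε ≤ z.re → r ≤ |z.im| →
      HasLowerBound (waveOperator hA B) z (ε / 4) := by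
  -- The two summands are what `h8` and `h9` need: dividing `h1` by `r / α` leaves coefficient at
  -- most `1` on `P * Y` and at most `ε / 2` on `Y ^ 2`.
  set r : ℝ := α * (3 + γ) + 2 * γ * α ^ 2 / ε with hr
  have hr0 : 0 < r := by positivity
  refine ⟨r, hr0, fun z hz hzi y => ?_⟩
  have h := re_mul_norm_sq_add_le z y
  have hi := abs_im_mul_le z y
  have hs := hsector ⟨y.1.snd, y.2.2.2⟩
  have hd := hdiss ⟨y.1.snd, y.2.2.2⟩
  have hY := StateSpace.norm_sq (y : StateSpace hA)
  simp only at hs hd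
  set b := (inner ℂ (B ⟨y.1.snd, y.2.2.2⟩) y.1.snd).re
  set P := ‖z • (y : StateSpace hA) - waveOperator hA B y‖
  set Y := ‖(y : StateSpace hA)‖
  set U := ‖y.1.fst‖ ^ 2
  set V := ‖y.1.snd‖ ^ 2
  have hY0 : 0 ≤ Y := norm_nonneg _
  have hP0 : 0 ≤ P := norm_nonneg _
  have hb : -b ≤ P * Y + α * Y ^ 2 := by nlinarith [sq_nonneg Y]
  have h1 : r * |U - V| ≤ (3 + γ) * (P * Y) + γ * α * Y ^ 2 := by
    have h2 : r * |U - V| ≤ |z.im| * |U - V| := by gcongr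
    have h3 : γ * (-b) ≤ γ * (P * Y + α * Y ^ 2) := by gcongr
    linarith
  have h4 : α * |U - V| ≤ P * Y + ε / 2 * Y ^ 2 := by
    have h5 : r * (α * |U - V|) ≤ r * (P * Y + ε / 2 * Y ^ 2) := by
      have h6 : r * ε = α * (3 + γ) * ε + 2 * γ * α ^ 2 := by rw [hr]; field_simp
      have h7 : α * (r * |U - V|) ≤ α * ((3 + γ) * (P * Y) + γ * α * Y ^ 2) := by gcongr
      have h8 : α * (3 + γ) * (P * Y) ≤ r * (P * Y) := by
        have : α * (3 + γ) ≤ r := by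
          rw [hr]; exact le_add_of_nonneg_right (by positivity)
        gcongr
      have h9 : γ * α ^ 2 * Y ^ 2 ≤ r * (ε / 2) * Y ^ 2 := by
        have : γ * α ^ 2 ≤ r * (ε / 2) := by
          have : 0 ≤ α * (3 + γ) * ε := by positivity
          linarith
        gcongr
      linarith
    exact le_of_mul_le_mul_left h5 hr0
  -- Near equipartition, the damping `2αV` is nearly `αY²` and cancels the `-α` in `Re z`. Of `ε
  -- Y²`, half is spent on the defect and the rest is bounded by `2 P Y`, whence `ε / 4`.
  have h10 : α * (Y ^ 2 - |U - V|) ≤ 2 * α * V := by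
    have : α * (U - V) ≤ α * |U - V| := by gcongr; exact le_abs_self _
    rw [hY]; linarith
  have h11 : (-α + ε) * Y ^ 2 ≤ z.re * Y ^ 2 := by gcongr
  rcases hY0.eq_or_lt with h0 | h0
  · rw [← h0, mul_zero]; exact hP0
  · refine le_of_mul_le_mul_right ?_ h0
    linarith

/-- With `Re z = 0` the damping bounds `V` with no loss, and the imaginary part bounds `U - V`; then
`Y² = 2V + (U - V)`. The constant degenerates as `Im z → 0`. -/
theorem exists_waveOperator_hasLowerBound_im (hα : 0 < α)
    (hsector : ∀ v : B.domain,
      γ * (inner ℂ (B v) (v : H)).re ≤ -|(inner ℂ (B v) (v : H)).im|)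
    (hdiss : ∀ v : B.domain, (inner ℂ (B v) (v : H)).re ≤ -2 * α * ‖(v : H)‖ ^ 2)
    (hγ : 0 ≤ γ) {z : ℂ} (hz : z.re = 0) (hzi : z.im ≠ 0) :
    ∃ c : ℝ, 0 < c ∧ HasLowerBound (waveOperator hA B) z c := by
  have hi0 : 0 < |z.im| := abs_pos.2 hzi
  set k : ℝ := 1 / α + (3 + γ) / |z.im| with hk
  have hk0 : 0 < k := by positivity
  refine ⟨k⁻¹, inv_pos.2 hk0, fun y => ?_⟩
  have h := re_mul_norm_sq_add_le z y
  have hi := abs_im_mul_le z y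
  have hs := hsector ⟨y.1.snd, y.2.2.2⟩
  have hd := hdiss ⟨y.1.snd, y.2.2.2⟩
  have hY := StateSpace.norm_sq (y : StateSpace hA)
  simp only at hs hd
  rw [hz, zero_mul, zero_sub] at h
  rw [inv_mul_le_iff₀ hk0]
  set b := (inner ℂ (B ⟨y.1.snd, y.2.2.2⟩) y.1.snd).re
  set P := ‖z • (y : StateSpace hA) - waveOperator hA B y‖
  set Y := ‖(y : StateSpace hA)‖
  set U := ‖y.1.fst‖ ^ 2
  set V := ‖y.1.snd‖ ^ 2
  have hY0 : 0 ≤ Y := norm_nonneg _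
  have hP0 : 0 ≤ P := norm_nonneg _
  have h1 : 2 * V ≤ 1 / α * (P * Y) := by
    rw [one_div, ← div_eq_inv_mul, le_div_iff₀ hα]; linarith
  have h2 : U - V ≤ (3 + γ) / |z.im| * (P * Y) := by
    rw [div_mul_eq_mul_div, le_div_iff₀ hi0]
    have h3 : γ * (-b) ≤ γ * (P * Y) := by gcongr
    have h4 : |z.im| * (U - V) ≤ |z.im| * |U - V| := by gcongr; exact le_abs_self _
    linarith
  rcases hY0.eq_or_lt with h0 | h0
  · rw [← h0]; positivity
  · refine le_of_mul_le_mul_right ?_ h0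
    rw [hk]
    linarith

/-- At `z = 0` the system is solved explicitly: `v = -F.fst`, and applying `A^{-1/2}` to the second
equation gives `A^{1/2} u = A^{-1/2} F.snd + K A^{1/2} v`. -/
theorem exists_waveOperator_hasLowerBound_zero
    (hbdd : ∃ K : H →L[ℂ] H, ∀ (v : H) (hv : v ∈ hA.sqrt.domain) (hv' : v ∈ B.domain),
      K (hA.sqrt ⟨v, hv⟩) = hA.invSqrt (B ⟨v, hv'⟩)) :
    ∃ c : ℝ, 0 < c ∧ HasLowerBound (waveOperator hA B) 0 c := by
  obtain ⟨K, hK⟩ := hbdd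
  refine ⟨(2 * ‖hA.invSqrt‖ + ‖K‖ + 1)⁻¹, by positivity, fun y => ?_⟩
  rw [inv_mul_le_iff₀ (by positivity)]
  set F := (0 : ℂ) • (y : StateSpace hA) - waveOperator hA B y with hF
  set v := EnergySpace.mk hA y.1.snd y.2.2.1 with hv
  have hfst : ‖F.fst‖ ≤ ‖F‖ :=
    abs_le_of_sq_le_sq' (by rw [StateSpace.norm_sq]; nlinarith [sq_nonneg ‖F.snd‖])
      (norm_nonneg _) |>.2
  have hsnd : ‖F.snd‖ ≤ ‖F‖ :=
    abs_le_of_sq_le_sq' (by rw [StateSpace.norm_sq]; nlinarith [sq_nonneg ‖F.fst‖])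
      (norm_nonneg _) |>.2
  have hvF : ‖EnergySpace.root hA v‖ ≤ ‖F‖ := by
    have : F.fst = -v := by rw [hF, waveOperator_residual_fst, zero_smul, zero_sub]
    rw [this, norm_neg, EnergySpace.norm_def] at hfst
    exact hfst
  have hv1 : ‖y.1.snd‖ ≤ ‖hA.invSqrt‖ * ‖F‖ := by
    have h1 : y.1.snd = hA.invSqrt (EnergySpace.root hA v) := (EnergySpace.invSqrt_root v).symm
    rw [h1]
    exact (hA.invSqrt.le_opNorm _).trans (by gcongr)
  have hu : EnergySpace.root hA y.1.fst =
      hA.invSqrt F.snd + K (EnergySpace.root hA v) := by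
    have h1 : K (EnergySpace.root hA v) = hA.invSqrt (B ⟨y.1.snd, y.2.2.2⟩) :=
      hK y.1.snd y.2.2.1 y.2.2.2
    rw [h1, ← map_add, hF, waveOperator_residual_snd, zero_smul, zero_add, sub_add_cancel,
      EnergySpace.invSqrt_apply]
  have hu1 : ‖y.1.fst‖ ≤ ‖hA.invSqrt‖ * ‖F‖ + ‖K‖ * ‖F‖ := by
    rw [EnergySpace.norm_def, hu]
    refine (norm_add_le _ _).trans (add_le_add ?_ ?_)
    · exact (hA.invSqrt.le_opNorm _).trans (by gcongr)
    · exact (K.le_opNorm _).trans (by gcongr)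
  have hy : ‖(y : StateSpace hA)‖ ≤ ‖y.1.fst‖ + ‖y.1.snd‖ :=
    abs_le_of_sq_le_sq' (by
      rw [StateSpace.norm_sq]
      nlinarith [mul_nonneg (norm_nonneg y.1.fst) (norm_nonneg y.1.snd)])
      (by positivity) |>.2
  linarith [norm_nonneg F]

end Wave
end SecondOrder

/-! ### Negativity of the spectral bound and the growth estimate. -/

namespace SecondOrder
open Filter Topology Set

section Main

variable {H : Type*} [NormedAddCommGroup H] [InnerProductSpace ℂ H] [CompleteSpace H]
  {A B : H →ₗ.[ℂ] H} {hA : IsStrictlyPositive A} {γ α : ℝ}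
  {T : ℝ → StateSpace hA →L[ℂ] StateSpace hA}

/-- The closed right half plane, enlarged by a strip, lies in the resolvent set of the operator
matrix. -/
theorem exists_strip_subset_resolventSet_waveOperator
    (hbdd : ∃ K : H →L[ℂ] H, ∀ (v : H) (hv : v ∈ hA.sqrt.domain) (hv' : v ∈ B.domain),
      K (hA.sqrt ⟨v, hv⟩) = hA.invSqrt (B ⟨v, hv'⟩))
    (hγ : 0 ≤ γ) (hα : 0 < α)
    (hsector : ∀ v : B.domain,
      γ * (inner ℂ (B v) (v : H)).re ≤ -|(inner ℂ (B v) (v : H)).im|)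
    (hdiss : ∀ v : B.domain, (inner ℂ (B v) (v : H)).re ≤ -2 * α * ‖(v : H)‖ ^ 2)
    (hT : IsC0Semigroup T) (hgen : IsGenerator T (waveOperator hA B))
    (hcontr : ∀ t : ℝ, 0 ≤ t → ‖T t‖ ≤ 1) :
    ∃ δ : ℝ, 0 < δ ∧ ∀ z : ℂ, -δ < z.re → z ∈ resolventSet (waveOperator hA B) := by
  have hpos : ∀ z : ℂ, 0 < z.re → z ∈ resolventSet (waveOperator hA B) := fun z hz =>
    hT.mem_resolventSet hgen hcontr hz hz (waveOperator_hasLowerBound_re hdiss hα z)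
  have himag : ∀ z : ℂ, z.re = 0 → z ∈ resolventSet (waveOperator hA B) := by
    intro z hz
    have hLB : ∃ c : ℝ, 0 < c ∧ HasLowerBound (waveOperator hA B) z c := by
      by_cases hzi : z.im = 0
      · have h0 : z = 0 := Complex.ext hz hzi
        rw [h0]
        exact exists_waveOperator_hasLowerBound_zero hbdd
      · exact exists_waveOperator_hasLowerBound_im hα hsector hdiss hγ hz hzi
    obtain ⟨c, hc, h⟩ := hLB
    -- A shift by `c / 4` reaches the open right half plane and stays within the admissible distance
    -- `c / 2`.
    refine h.mem_resolventSet_of_near (z' := z + ((c / 4 : ℝ) : ℂ))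
      (hpos _ (by simp [hz, hc])) ?_
    rw [sub_add_cancel_left, norm_neg, Complex.norm_real, Real.norm_of_nonneg (by positivity)]
    linarith
  obtain ⟨r, hr, hlarge⟩ := waveOperator_hasLowerBound_of_im_large (hA := hA) hγ hα hsector hdiss
    (half_pos hα)
  have hfar : ∀ z : ℂ, -(α / 2) ≤ z.re → r ≤ |z.im| →
      z ∈ resolventSet (waveOperator hA B) := by
    intro z hz hzi
    -- A horizontal segment through `z` into the right half plane keeps `Im z` fixed, so the
    -- high-frequency bound holds all along it.
    have hs : IsPreconnected (Icc (-(α / 2)) (max 1 z.re) ×ℂ {z.im}) :=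
      (((convex_Icc (𝕜 := ℝ) _ _).linear_preimage Complex.reLm).inter
        ((convex_singleton (𝕜 := ℝ) _).linear_preimage Complex.imLm)).isPreconnected
    have hm : (1 : ℝ) ≤ max 1 z.re := le_max_left _ _
    refine subset_resolventSet_of_hasLowerBound hs ⟨⟨1, z.im⟩, ?_, hpos _ one_pos⟩ ?_ ?_
    · exact Complex.mem_reProdIm.2 ⟨⟨by linarith, hm⟩, rfl⟩
    · intro z' hz'
      obtain ⟨⟨h1, -⟩, h2⟩ := Complex.mem_reProdIm.1 hz'
      rw [mem_singleton_iff] at h2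
      exact ⟨α / 2 / 4, by positivity, hlarge z' (by linarith) (by rwa [h2])⟩
    · exact Complex.mem_reProdIm.2 ⟨⟨hz, le_max_right _ _⟩, rfl⟩
  have hK : IsCompact ({0} ×ℂ Icc (-r) r) := isCompact_singleton.reProdIm isCompact_Icc
  obtain ⟨δ, hδ, hthick⟩ := hK.exists_thickening_subset_open
    (isOpen_resolventSet (L := waveOperator hA B))
    fun z hz => himag z (Complex.mem_reProdIm.1 hz).1
  refine ⟨min δ (α / 2), lt_min hδ (half_pos hα), fun z hz => ?_⟩
  have h1 := min_le_left δ (α / 2)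
  have h2 := min_le_right δ (α / 2)
  rcases lt_or_ge 0 z.re with hz0 | hz0
  · exact hpos z hz0
  rcases le_or_gt r |z.im| with hzi | hzi
  · exact hfar z (by linarith) hzi
  · refine hthick (Metric.mem_thickening_iff.2 ⟨⟨0, z.im⟩, ?_, ?_⟩)
    · exact Complex.mem_reProdIm.2 ⟨rfl, abs_le.1 hzi.le⟩
    · rw [Complex.dist_of_im_eq (show z.im = (⟨0, z.im⟩ : ℂ).im from rfl), Real.dist_eq, sub_zero, abs_of_nonpos hz0]
      linarith

/-- The half plane `Re z ≥ ω` is covered by three regions: large `|Im z|` (energy estimate), `Re z ≥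
1` (dissipativity), and a compact rectangle free of spectrum. -/
theorem exists_norm_le_exp_of_max_spectralBound_lt
    (hγ : 0 ≤ γ) (hα : 0 < α)
    (hsector : ∀ v : B.domain,
      γ * (inner ℂ (B v) (v : H)).re ≤ -|(inner ℂ (B v) (v : H)).im|)
    (hdiss : ∀ v : B.domain, (inner ℂ (B v) (v : H)).re ≤ -2 * α * ‖(v : H)‖ ^ 2)
    (hT : IsC0Semigroup T) (hgen : IsGenerator T (waveOperator hA B))
    (hcontr : ∀ t : ℝ, 0 ≤ t → ‖T t‖ ≤ 1) {ω : ℝ}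
    (hω : max (spectralBound (waveOperator hA B)) ((-α : ℝ) : EReal) < (ω : EReal)) :
    ∃ M : ℝ, 1 ≤ M ∧ ∀ t : ℝ, 0 ≤ t → ‖T t‖ ≤ M * Real.exp (ω * t) := by
  obtain ⟨hs, hωα⟩ := max_lt_iff.1 hω
  rw [EReal.coe_lt_coe_iff] at hωα
  obtain ⟨r, hr, hlarge⟩ := waveOperator_hasLowerBound_of_im_large (hA := hA) hγ hα hsector hdiss
    (show 0 < ω + α by linarith)
  obtain ⟨c, hc, hcompact⟩ := exists_hasLowerBound_of_isCompact
    (isCompact_Icc.reProdIm isCompact_Icc : IsCompact (Icc ω 1 ×ℂ Icc (-r) r)) fun z hz =>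
      mem_resolventSet_of_spectralBound_lt
        (hs.trans_le (EReal.coe_le_coe_iff.2 (Complex.mem_reProdIm.1 hz).1.1))
  refine hT.exists_norm_le_exp_of_lower_bound hgen hcontr
    (c := min c (min 1 ((ω + α) / 4))) (lt_min hc (lt_min one_pos (by linarith))) fun z hz => ?_
  rcases le_or_gt r |z.im| with hzi | hzi
  · exact (hlarge z (by linarith) hzi).mono ((min_le_right _ _).trans (min_le_right _ _))
  rcases le_or_gt 1 z.re with hz1 | hz1
  · exact (waveOperator_hasLowerBound_re hdiss hα z).mono
      (((min_le_right _ _).trans (min_le_left _ _)).trans hz1)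
  · exact (hcompact z (Complex.mem_reProdIm.2 ⟨⟨hz, hz1.le⟩, abs_le.1 hzi.le⟩)).mono
      (min_le_left _ _)

end Main
end SecondOrder

theorem proposition3p1 {H : Type*} [NormedAddCommGroup H] [InnerProductSpace ℂ H]
    [CompleteSpace H] (A B : H →ₗ.[ℂ] H) (hA : SecondOrder.IsStrictlyPositive A)
    (hBclosed : B.IsClosed) (hBdense : Dense (B.domain : Set H))
    (hdense : Dense ((B.domain ⊓ hA.sqrt.domain : Submodule ℂ H) : Set H))
    (hdense' : Dense {x : H | ∃ v : hA.sqrt.domain, (v : H) ∈ B.domain ∧ hA.sqrt v = x})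
    (hbdd : ∃ K : H →L[ℂ] H, ∀ (v : H) (hv : v ∈ hA.sqrt.domain) (hv' : v ∈ B.domain),
      K (hA.sqrt ⟨v, hv⟩) = hA.invSqrt (B ⟨v, hv'⟩))
    (γ α : ℝ) (hγ : 0 ≤ γ) (hα : 0 < α)
    (hsector : ∀ v : B.domain,
      γ * (inner ℂ (B v) (v : H)).re ≤ -|(inner ℂ (B v) (v : H)).im|)
    (hdiss : ∀ v : B.domain, (inner ℂ (B v) (v : H)).re ≤ -2 * α * ‖(v : H)‖ ^ 2)
    (T : ℝ → SecondOrder.StateSpace hA →L[ℂ] SecondOrder.StateSpace hA)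
    (hT : SecondOrder.IsC0Semigroup T)
    (hgen : SecondOrder.IsGenerator T (SecondOrder.waveOperator hA B))
    (hcontr : ∀ t : ℝ, 0 ≤ t → ‖T t‖ ≤ 1) :
    SecondOrder.growthBound T ≤
        max (SecondOrder.spectralBound (SecondOrder.waveOperator hA B)) ((-α : ℝ) : EReal) ∧
      max (SecondOrder.spectralBound (SecondOrder.waveOperator hA B)) ((-α : ℝ) : EReal) < 0 ∧
      ∃ M ω : ℝ, 1 ≤ M ∧ 0 < ω ∧ ∀ t : ℝ, 0 ≤ t → ‖T t‖ ≤ M * Real.exp (-ω * t) := by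
  have hexp := fun ω : ℝ => SecondOrder.exists_norm_le_exp_of_max_spectralBound_lt hγ hα hsector
    hdiss hT hgen hcontr (ω := ω)
  obtain ⟨δ, hδ, hstrip⟩ := SecondOrder.exists_strip_subset_resolventSet_waveOperator hbdd hγ hα
    hsector hdiss hT hgen hcontr
  have hneg : max (SecondOrder.spectralBound (SecondOrder.waveOperator hA B))
      ((-α : ℝ) : EReal) < 0 := by
    refine max_lt ((SecondOrder.spectralBound_le hstrip).trans_lt ?_) ?_
    · exact EReal.coe_lt_coe_iff.2 (neg_lt_zero.2 hδ)
    · exact EReal.coe_lt_coe_iff.2 (neg_lt_zero.2 hα)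
  refine ⟨?_, hneg, ?_⟩
  · refine EReal.le_of_forall_lt_iff_le.1 fun ω hω => ?_
    obtain ⟨M, hM⟩ := hexp ω hω
    exact sInf_le ⟨ω, rfl, M, hM⟩
  · obtain ⟨ω, hω, hω0⟩ := EReal.lt_iff_exists_real_btwn.1 hneg
    obtain ⟨M, hM1, hM⟩ := hexp ω hω
    refine ⟨M, -ω, hM1, neg_pos.2 (EReal.coe_lt_coe_iff.1 hω0), fun t ht => ?_⟩
    rw [neg_neg]
    exact hM t ht
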